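/- Let $M$ be a compact (smooth, boundaryless) Riemannian manifold, let $m$ be its normalized Riemannian volume (Lebesgue measure), and let $f\colon M\to M$ be a $C^2$ local diffeomorphism. For $\sigma\in(0,1)$, an integer $n\ge 1$ is called a $\sigma$-hyperbolic time for $x\in M$ if $$\prod_{j=n-k}^{n-1}\bigl\|Df(f^j(x))^{-1}\bigr\|\le\sigma^k\qquad\text{for all }1\le k\le n,$$ where $\|\cdot\|$ is the operator norm with respect to the Riemannian metric. The frequency of $\sigma$-hyperbolic times for $x$ is said to be greater than $\theta>0$ if, for all sufficiently large $n$, there are $\sigma$-hyperbolic times $n_1<n_2<\dots<n_\ell\le n$ for $x$ with $\ell\ge\theta n$. Theorem D. Suppose that for some $\sigma\in(0,1)$ the first $\sigma$-hyperbolic time map $h$, which assigns to $x$ the smallest $\sigma$-hyperbolic time for $x$, is defined at $m$-almost every point and is $m$-integrable. Then there are $\hat\sigma\in(0,1)$ and $\theta>0$ such that for $m$-almost every $x\in M$ the frequency of $\hat\sigma$-hyperbolic times for $x$ is greater than $\theta$. -/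

import Mathlib

open scoped Manifold ContDiff Bundle

noncomputable section

namespace HyperbolicTimes

open MeasureTheory Filter Bundle

/-- The Riemannian volume density `√(det (g_{ij}(y)))` at the coordinate point `y` in the preferred
chart `φ` at `x`: here `g_{ij}(y) = ⟪∂_i, ∂_j⟫` is the Gram matrix of the coordinate vector fields
`∂_i = D(φ⁻¹)(y) e_i` for the Riemannian inner product on the tangent space at `φ⁻¹(y)`. -/
def volumeDensity {d : ℕ} {M : Type*} [TopologicalSpace M]
    [ChartedSpace (EuclideanSpace ℝ (Fin d)) M]
    [RiemannianBundle (fun x : M => TangentSpace (𝓡 d) x)]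
    (x : M) (y : EuclideanSpace ℝ (Fin d)) : ℝ :=
  Real.sqrt (Matrix.gram ℝ (fun i : Fin d =>
    mfderiv (𝓡 d) (𝓡 d) (chartAt (EuclideanSpace ℝ (Fin d)) x).symm y
      (EuclideanSpace.single i (1 : ℝ) : EuclideanSpace ℝ (Fin d)))).det

/-- The Riemannian volume measure on the domain of the preferred chart `φ` at `x` (extended by zero
outside this domain): the image under `φ⁻¹` of the measure `√(det g_{ij}) dy` on the target of
`φ`. -/
def chartVolume {d : ℕ} {M : Type*} [TopologicalSpace M]
    [ChartedSpace (EuclideanSpace ℝ (Fin d)) M]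
    [RiemannianBundle (fun x : M => TangentSpace (𝓡 d) x)] [MeasurableSpace M]
    (x : M) : Measure M :=
  ((volume.restrict (chartAt (EuclideanSpace ℝ (Fin d)) x).target).withDensity
    (fun y => ENNReal.ofReal (volumeDensity x y))).map
      (chartAt (EuclideanSpace ℝ (Fin d)) x).symm

/-- The Riemannian volume measure: the smallest measure that dominates the Riemannian volume of each
chart domain. As the chart volumes agree on overlaps, it restricts to the chart volume on every
chart domain. -/
def riemannianVolume (d : ℕ) (M : Type*) [TopologicalSpace M]
    [ChartedSpace (EuclideanSpace ℝ (Fin d)) M]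
    [RiemannianBundle (fun x : M => TangentSpace (𝓡 d) x)] [MeasurableSpace M] : Measure M :=
  ⨆ x : M, chartVolume (d := d) x

/-- Lebesgue measure on a compact Riemannian manifold: the normalized Riemannian volume. -/
def lebesgue (d : ℕ) (M : Type*) [TopologicalSpace M]
    [ChartedSpace (EuclideanSpace ℝ (Fin d)) M]
    [RiemannianBundle (fun x : M => TangentSpace (𝓡 d) x)] [MeasurableSpace M] : Measure M :=
  (riemannianVolume d M Set.univ)⁻¹ • riemannianVolume d M

/-- `‖Df(x)⁻¹‖`, the operator norm of `Df(x)⁻¹ : T_{f x} M → T_x M` for the Riemannian norms. -/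
def normDerivInv (d : ℕ) {M : Type*} [TopologicalSpace M]
    [ChartedSpace (EuclideanSpace ℝ (Fin d)) M] [IsManifold (𝓡 d) ∞ M]
    [RiemannianBundle (fun x : M => TangentSpace (𝓡 d) x)] (f : M → M) (x : M) : ℝ :=
  ‖(mfderiv (𝓡 d) (𝓡 d) f x).inverse‖

/-- The positive integer `n` is a `σ`-hyperbolic time for `x`. -/
def IsHyperbolicTime (d : ℕ) {M : Type*} [TopologicalSpace M]
    [ChartedSpace (EuclideanSpace ℝ (Fin d)) M] [IsManifold (𝓡 d) ∞ M]
    [RiemannianBundle (fun x : M => TangentSpace (𝓡 d) x)]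
    (f : M → M) (σ : ℝ) (x : M) (n : ℕ) : Prop :=
  1 ≤ n ∧ ∀ k : ℕ, 1 ≤ k → k ≤ n →
    ∏ j ∈ Finset.Ico (n - k) n, normDerivInv d f (f^[j] x) ≤ σ ^ k

/-- The first `σ`-hyperbolic time of `x` (meaningful only if `x` has a `σ`-hyperbolic time). -/
def firstHyperbolicTime (d : ℕ) {M : Type*} [TopologicalSpace M]
    [ChartedSpace (EuclideanSpace ℝ (Fin d)) M] [IsManifold (𝓡 d) ∞ M]
    [RiemannianBundle (fun x : M => TangentSpace (𝓡 d) x)]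
    (f : M → M) (σ : ℝ) (x : M) : ℕ :=
  sInf {n : ℕ | IsHyperbolicTime d f σ x n}

/-- The frequency of `σ`-hyperbolic times for `x` is greater than `θ`: for all large `n` there are
at least `θ n` distinct `σ`-hyperbolic times for `x` that are at most `n`. -/
def FrequencyGreater (d : ℕ) {M : Type*} [TopologicalSpace M]
    [ChartedSpace (EuclideanSpace ℝ (Fin d)) M] [IsManifold (𝓡 d) ∞ M]
    [RiemannianBundle (fun x : M => TangentSpace (𝓡 d) x)]
    (f : M → M) (σ : ℝ) (x : M) (θ : ℝ) : Prop :=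
  ∀ᶠ n : ℕ in atTop, ∃ s : Finset ℕ,
    (∀ i ∈ s, i ≤ n ∧ IsHyperbolicTime d f σ x i) ∧ θ * (n : ℝ) ≤ (s.card : ℝ)

end HyperbolicTimes

end

/-!
Hyperbolic times of local diffeomorphisms: integrability of the first hyperbolic time implies
positive frequency.

Let `a x = ‖Df(x)⁻¹‖`. Almost every point has a `σ`-hyperbolic time, hence a stretch of its orbit
along which the average of `log a` is at most `log σ < 0`. If an invariant measure equivalent to
the volume `m` were at hand, the ergodic theorem would give negative averages of `log a` over all
long orbit segments, and Pliss's lemma (`exists_finset_pliss`) would turn these into a positive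
frequency of hyperbolic times for a rate `σ' > σ`. No invariant measure is constructed; it is
enough that all push-forwards of `m` under the iterates of `f` are dominated by one finite measure
`ν ≪ m`, and this is where the integrability of the first hyperbolic time enters.

*Domination* (`exists_dominating_measure`). Split the points `x` with `f^[j] x ∈ E` according to the
last hyperbolic time `i ≤ j` of `x`. As hyperbolic times concatenate, `f^[i] x` has no hyperbolic
time up to `j - i`. At a hyperbolic time `i`, the map `f^[i]` has an inverse branch on a ball of
fixed radius which contracts exponentially backwards along the orbit, so that its distortion is
bounded independently of `i`, and branches that meet coincide. So the push-forward under `f^[i]` of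
`m` restricted to the points with hyperbolic time `i` has density at most a constant `C`
(`exists_measure_isHypTime_inter_preimage_le`). Summing over `k = j - i`, all push-forwards are
dominated by a multiple of `∑ k, (f^[k])_* (m | no hyperbolic time up to k)`, plus the term without
any hyperbolic time, which has the same form. The total mass of this sum is the integral of the
first hyperbolic time.

*Averages* (`ae_eventually_birkhoffSum_le`). Suppose that on a set `B` of positive measure
infinitely many averages of `u = log a` exceed `c > b = log σ`. For `b < c' < c`, the orbit of a
point of `B` can be cut into blocks with averages at most `b`, and also into blocks with averages at
least `c'`; only visits to the set where the blocks are longer than `N` are an obstruction. Adding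
the two estimates and integrating over `B`, the domination shows that `(c' - b) m(B)` is at most
a constant times the `ν`-measure of this set, which tends to `0` with `N`.

*Geometry.* All metric statements refer to the Riemannian distance. The norm of the derivative of a
local inverse is continuous (`continuousAt_norm_mfderiv`) and bounds its local Lipschitz constant
(`edist_le_of_enorm_mfderiv_le`). The Riemannian volume is computed in charts
(`chartVolume_image`, `riemannianVolume_eq_chartVolume`), and as `f` is `C²`, the logarithm of the
Jacobian of a local inverse is locally Lipschitz (`exists_distortion_bound`). Compactness makes all
constants uniform (`exists_uniform_isBranch`).

In dimension zero the weight `a` vanishes identically and has no logarithm; there every positive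
integer is a hyperbolic time.
-/

namespace HyperbolicTimes

open MeasureTheory Filter Set Topology Metric Bundle Manifold
open scoped ENNReal NNReal

/-! ### Inverse branches with bounded distortion -/

/-- `g` is an inverse branch of `f` on `B`, sending `f x` back to `x`, which is Lipschitz with
constant `Λ` and whose distortion with respect to `μ` is controlled by `L`: on a set `S` of
diameter at most `r`, the map `g` multiplies the measure by a constant, up to a factor `exp (L r)`.
Stating the distortion through the measure of images avoids choosing a Jacobian. -/
structure IsBranch {X : Type*} [PseudoEMetricSpace X] [MeasurableSpace X] (μ : Measure X)
    (f : X → X) (B : Set X) (x : X) (Λ L : ℝ) (g : X → X) : Prop where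
  apply_base : g (f x) = x
  right_inv : ∀ y ∈ B, f (g y) = y
  edist_le : ∀ y ∈ B, ∀ z ∈ B, edist (g y) (g z) ≤ ENNReal.ofReal Λ * edist y z
  measurableSet_image : ∀ E ⊆ B, MeasurableSet E → MeasurableSet (g '' E)
  distortion : ∀ S ⊆ B, ∀ r : ℝ, 0 ≤ r → ediam S ≤ ENNReal.ofReal r →
    ∃ c : ℝ≥0∞, c ≠ 0 ∧ ∀ E ⊆ S, MeasurableSet E →
      c * μ E ≤ μ (g '' E) ∧ μ (g '' E) ≤ ENNReal.ofReal (Real.exp (L * r)) * (c * μ E)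

section Branch

variable {X : Type*} [PseudoEMetricSpace X] [MeasurableSpace X] {μ : Measure X}

lemma isBranch_id (B : Set X) (x : X) : IsBranch μ id B x 1 0 id where
  apply_base := rfl
  right_inv _ _ := rfl
  edist_le y _ z _ := by simp
  measurableSet_image E _ hE := by simpa using hE
  distortion S _ r _ _ := ⟨1, one_ne_zero, fun E _ _ => by simp⟩

lemma IsBranch.mono {f g : X → X} {B : Set X} {x : X} {Λ L Λ' L' : ℝ}
    (h : IsBranch μ f B x Λ L g) (hΛ : Λ ≤ Λ') (hL : L ≤ L') : IsBranch μ f B x Λ' L' g where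
  apply_base := h.apply_base
  right_inv := h.right_inv
  edist_le y hy z hz := (h.edist_le y hy z hz).trans (by gcongr)
  measurableSet_image := h.measurableSet_image
  distortion S hS r hr hd := by
    obtain ⟨c, hc, H⟩ := h.distortion S hS r hr hd
    exact ⟨c, hc, fun E hE hm => ⟨(H E hE hm).1, (H E hE hm).2.trans (by gcongr)⟩⟩

lemma IsBranch.mono_set {f g : X → X} {B B' : Set X} {x : X} {Λ L : ℝ}
    (h : IsBranch μ f B x Λ L g) (hB : B' ⊆ B) :
    IsBranch μ f B' x Λ L g where
  apply_base := h.apply_base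
  right_inv y hy := h.right_inv y (hB hy)
  edist_le y hy z hz := h.edist_le y (hB hy) z (hB hz)
  measurableSet_image E hE := h.measurableSet_image E (hE.trans hB)
  distortion S hS := h.distortion S (hS.trans hB)

lemma IsBranch.const_smul {f g : X → X} {B : Set X} {x : X} {Λ L : ℝ}
    (h : IsBranch μ f B x Λ L g) (k : ℝ≥0∞) :
    IsBranch (k • μ) f B x Λ L g where
  apply_base := h.apply_base
  right_inv := h.right_inv
  edist_le := h.edist_le
  measurableSet_image := h.measurableSet_image
  distortion S hS r hr hd := by
    obtain ⟨c, hc, H⟩ := h.distortion S hS r hr hd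
    refine ⟨c, hc, fun E hE hm => ?_⟩
    simp only [Measure.smul_apply, smul_eq_mul]
    rw [mul_left_comm c k, mul_left_comm _ k]
    exact ⟨mul_le_mul_right (H E hE hm).1 k, mul_le_mul_right (H E hE hm).2 k⟩

/-- Inverse branches compose. The distortion of the outer branch is weighted by the contraction of
the inner one, which is what makes the total distortion at hyperbolic times summable. -/
lemma IsBranch.comp {f F g G : X → X} {B B' : Set X} {x : X} {Λ L Λ' L' : ℝ}
    (h : IsBranch μ f B x Λ L g) (h' : IsBranch μ F B' (f x) Λ' L' G)
    (hΛ : 0 ≤ Λ) (hΛ' : 0 ≤ Λ') (hmaps : MapsTo G B' B) :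
    IsBranch μ (F ∘ f) B' x (Λ * Λ') (L * Λ' + L') (g ∘ G) where
  apply_base := by simp [h'.apply_base, h.apply_base]
  right_inv y hy := by
    simp [h.right_inv _ (hmaps hy), h'.right_inv _ hy]
  edist_le y hy z hz := by
    calc edist (g (G y)) (g (G z)) ≤ ENNReal.ofReal Λ * edist (G y) (G z) :=
          h.edist_le _ (hmaps hy) _ (hmaps hz)
      _ ≤ ENNReal.ofReal Λ * (ENNReal.ofReal Λ' * edist y z) := by
          gcongr; exact h'.edist_le _ hy _ hz
      _ = _ := by rw [ENNReal.ofReal_mul hΛ, mul_assoc]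
  measurableSet_image E hE hm := by
    rw [image_comp]
    exact h.measurableSet_image _ ((image_mono hE).trans hmaps.image_subset)
      (h'.measurableSet_image E hE hm)
  distortion S hS r hr hd := by
    obtain ⟨c', hc', H'⟩ := h'.distortion S hS r hr hd
    have hd2 : ediam (G '' S) ≤ ENNReal.ofReal (Λ' * r) := by
      refine ediam_image_le_iff.2 fun y hy z hz => ?_
      refine (h'.edist_le y (hS hy) z (hS hz)).trans ?_
      rw [ENNReal.ofReal_mul hΛ']
      gcongr
      exact (edist_le_ediam_of_mem hy hz).trans hd
    obtain ⟨c, hc, H⟩ := h.distortion (G '' S) ((image_mono hS).trans hmaps.image_subset)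
      (Λ' * r) (by positivity) hd2
    refine ⟨c * c', mul_ne_zero hc hc', fun E hE hm => ?_⟩
    have h1 := H' E hE hm
    have h2 := H (G '' E) (image_mono hE) (h'.measurableSet_image E (hE.trans hS) hm)
    rw [image_comp]
    constructor
    · refine le_trans ?_ h2.1
      rw [mul_assoc]
      gcongr
      exact h1.1
    · refine h2.2.trans ?_
      calc ENNReal.ofReal (Real.exp (L * (Λ' * r))) * (c * μ (G '' E))
          ≤ ENNReal.ofReal (Real.exp (L * (Λ' * r))) *
            (c * (ENNReal.ofReal (Real.exp (L' * r)) * (c' * μ E))) := by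
              gcongr; exact h1.2
        _ = ENNReal.ofReal (Real.exp ((L * Λ' + L') * r)) * (c * c' * μ E) := by
              rw [show (L * Λ' + L') * r = L * (Λ' * r) + L' * r by ring, Real.exp_add,
                ENNReal.ofReal_mul (Real.exp_nonneg _)]
              ring

end Branch

/-- `n` is a `σ`-hyperbolic time for `x` with respect to the weight `a`, which plays the role of
`x ↦ ‖Df(x)⁻¹‖`. -/
def IsHypTime {X : Type*} (f : X → X) (a : X → ℝ) (σ : ℝ) (x : X) (n : ℕ) : Prop :=
  1 ≤ n ∧ ∀ k : ℕ, 1 ≤ k → k ≤ n → ∏ j ∈ Finset.Ico (n - k) n, a (f^[j] x) ≤ σ ^ k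

section HypTime

variable {X : Type*} {f : X → X} {a : X → ℝ} {σ : ℝ}

lemma IsHypTime.prod_range_le {x : X} {n : ℕ} (h : IsHypTime f a σ x n) :
    ∏ j ∈ Finset.range n, a (f^[j] x) ≤ σ ^ n := by
  have := h.2 n h.1 le_rfl
  rwa [Nat.sub_self, ← Finset.range_eq_Ico] at this

lemma prod_Ico_iterate (x : X) (m n t : ℕ) :
    ∏ j ∈ Finset.Ico (m + t) (n + t), a (f^[j] x) =
      ∏ j ∈ Finset.Ico m n, a (f^[j] (f^[t] x)) := by
  rw [← Finset.prod_Ico_add' (fun j => a (f^[j] x)) m n t]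
  exact Finset.prod_congr rfl fun j _ => by rw [Function.iterate_add_apply]

lemma IsHypTime.apply {x : X} {n : ℕ} (hn : 1 ≤ n) (h : IsHypTime f a σ x (n + 1)) :
    IsHypTime f a σ (f x) n := by
  refine ⟨hn, fun k hk hkn => ?_⟩
  have := h.2 k hk (by omega)
  rw [show n + 1 - k = n - k + 1 by omega, prod_Ico_iterate] at this
  simpa using this

/-- Hyperbolic times concatenate along an orbit. -/
lemma IsHypTime.add (ha : ∀ x, 0 ≤ a x) (hσ : 0 ≤ σ) {x : X} {i t : ℕ}
    (hi : IsHypTime f a σ x i) (ht : IsHypTime f a σ (f^[i] x) t) :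
    IsHypTime f a σ x (i + t) := by
  refine ⟨by have := hi.1; omega, fun k hk hkn => ?_⟩
  rcases le_or_gt k t with hkt | hkt
  · have := ht.2 k hk hkt
    rwa [← prod_Ico_iterate, show t - k + i = i + t - k by omega, add_comm t i] at this
  · have h1 := hi.2 (k - t) (by omega) (by omega)
    have h2 := ht.prod_range_le
    rw [Finset.range_eq_Ico, ← prod_Ico_iterate, zero_add, add_comm t i] at h2
    rw [← Finset.prod_Ico_consecutive _ (show i + t - k ≤ i by omega) (Nat.le_add_right i t),
      show k = (k - t) + t by omega, pow_add]
    rw [show i + t - (k - t + t) = i - (k - t) by omega]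
    exact mul_le_mul h1 h2 (Finset.prod_nonneg fun _ _ => ha _) (by positivity)

lemma isClosed_setOf_isHypTime [TopologicalSpace X] (hf : Continuous f) (ha : Continuous a)
    (n : ℕ) : IsClosed {x | IsHypTime f a σ x n} := by
  have : {x | IsHypTime f a σ x n} = {x | 1 ≤ n ∧ ∀ k : ℕ, 1 ≤ k → k ≤ n →
      ∏ j ∈ Finset.Ico (n - k) n, a (f^[j] x) ≤ σ ^ k} := rfl
  rw [this]
  by_cases hn : 1 ≤ n
  · simp only [hn, true_and, ofPred_forall]
    refine isClosed_iInter fun k => isClosed_iInter fun _ => isClosed_iInter fun _ => ?_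
    exact isClosed_le (continuous_finsetProd _ fun j _ => ha.comp (hf.iterate j))
      continuous_const
  · simp [hn]

end HypTime

section Iterate

variable {X : Type*} [PseudoEMetricSpace X] [MeasurableSpace X] {μ : Measure X}
  {f : X → X} {a : X → ℝ} {δ : ℝ≥0∞} {L τ : ℝ}

/-- At a `τ ^ 2`-hyperbolic time, the iterate has an inverse branch on a ball of a fixed radius
whose distortion does not depend on the time, and which contracts distances all along the backward
orbit. One of the two factors `τ` gained at each step pays for the loss `τ⁻¹` in the Lipschitz
constants of the branches of `f`, the other one makes the distortion summable. -/
lemma exists_isBranch_iterate (hτ0 : 0 < τ) (hτ1 : τ < 1) (hL : 0 ≤ L) (ha : ∀ x, 0 ≤ a x)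
    (hbr : ∀ x, ∃ g, IsBranch μ f (eball (f x) δ) x (τ⁻¹ * a x) L g) (n : ℕ) :
    ∀ x, IsHypTime f a (τ ^ 2) x n → ∃ G,
      IsBranch μ f^[n] (eball (f^[n] x) δ) x (∏ j ∈ Finset.range n, (τ⁻¹ * a (f^[j] x)))
        (L * ∑ i ∈ Finset.range n, τ ^ i) G ∧
      ∀ y ∈ eball (f^[n] x) δ, ∀ z ∈ eball (f^[n] x) δ, ∀ i ≤ n,
        edist (f^[i] (G y)) (f^[i] (G z)) ≤ edist y z := by
  have hprod : ∀ n x, IsHypTime f a (τ ^ 2) x n →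
      ∏ j ∈ Finset.range n, (τ⁻¹ * a (f^[j] x)) ≤ τ ^ n := by
    intro n x h
    rw [Finset.prod_mul_distrib, Finset.prod_const, Finset.card_range]
    calc τ⁻¹ ^ n * ∏ j ∈ Finset.range n, a (f^[j] x) ≤ τ⁻¹ ^ n * (τ ^ 2) ^ n := by
          gcongr; exact h.prod_range_le
      _ = τ ^ n := by rw [← mul_pow]; congr 1; field_simp
  have hpos : ∀ n x, 0 ≤ ∏ j ∈ Finset.range n, (τ⁻¹ * a (f^[j] x)) := fun n x =>
    Finset.prod_nonneg fun _ _ => mul_nonneg (by positivity) (ha _)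
  have hone : ∀ (n x), IsHypTime f a (τ ^ 2) x n →
      ENNReal.ofReal (∏ j ∈ Finset.range n, (τ⁻¹ * a (f^[j] x))) ≤ 1 := fun n x h =>
    ENNReal.ofReal_le_one.2 ((hprod n x h).trans (pow_le_one₀ hτ0.le hτ1.le))
  induction n with
  | zero => intro x h; exact absurd h.1 (by norm_num)
  | succ n ih =>
    intro x hx
    obtain ⟨g, hg⟩ := hbr x
    -- it suffices to find a non-expanding branch of the remaining `n` iterates at `f x`
    obtain ⟨G, hG, hG'⟩ : ∃ G,
      IsBranch μ f^[n] (eball (f^[n] (f x)) δ) (f x)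
        (∏ j ∈ Finset.range n, (τ⁻¹ * a (f^[j] (f x)))) (L * ∑ i ∈ Finset.range n, τ ^ i) G ∧
      (∏ j ∈ Finset.range n, (τ⁻¹ * a (f^[j] (f x))) ≤ τ ^ n) ∧
      ∀ y ∈ eball (f^[n] (f x)) δ, ∀ z ∈ eball (f^[n] (f x)) δ, ∀ i ≤ n,
        edist (f^[i] (G y)) (f^[i] (G z)) ≤ edist y z := by
      rcases Nat.eq_zero_or_pos n with rfl | hn
      · refine ⟨id, by simpa using isBranch_id _ _, by simp, fun y _ z _ i hi => ?_⟩
        obtain rfl : i = 0 := by omega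
        simp
      · have h1 := hx.apply hn
        obtain ⟨G, hG⟩ := ih _ h1
        exact ⟨G, hG.1, hprod n _ h1, hG.2⟩
    have hmaps : MapsTo G (eball (f^[n] (f x)) δ) (eball (f x) δ) := by
      intro y hy
      have hδ : (0 : ℝ≥0∞) < δ := zero_le.trans_lt (mem_eball.1 hy)
      have := hG'.2 y hy _ (mem_eball_self hδ) 0 (Nat.zero_le _)
      rw [hG.apply_base] at this
      exact lt_of_le_of_lt (by simpa using this) (mem_eball.1 hy)
    have hcomp := hg.comp hG (mul_nonneg (by positivity) (ha _)) (hpos _ _) hmaps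
    have hΛ : τ⁻¹ * a x * ∏ j ∈ Finset.range n, (τ⁻¹ * a (f^[j] (f x))) =
        ∏ j ∈ Finset.range (n + 1), (τ⁻¹ * a (f^[j] x)) := by
      rw [Finset.prod_range_succ']; simp [mul_comm]
    rw [hΛ] at hcomp
    have hB : IsBranch μ f^[n + 1] (eball (f^[n + 1] x) δ) x
        (∏ j ∈ Finset.range (n + 1), (τ⁻¹ * a (f^[j] x)))
        (L * ∑ i ∈ Finset.range (n + 1), τ ^ i) (g ∘ G) := by
      rw [Function.iterate_succ]
      refine hcomp.mono le_rfl ?_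
      rw [Finset.sum_range_succ, mul_add, add_comm]
      gcongr
      exact hG'.1
    refine ⟨g ∘ G, hB, fun y hy z hz i hi => ?_⟩
    rw [Function.iterate_succ_apply] at hy hz
    rcases Nat.eq_zero_or_pos i with rfl | hi0
    · refine (hB.edist_le y hy z hz).trans ?_
      calc _ ≤ 1 * edist y z := by gcongr; exact hone _ _ hx
        _ = _ := one_mul _
    · obtain ⟨i, rfl⟩ : ∃ k, i = k + 1 := ⟨i - 1, by omega⟩
      simp only [Function.comp_apply, Function.iterate_succ_apply]
      rw [hg.right_inv _ (hmaps hy), hg.right_inv _ (hmaps hz)]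
      exact hG'.2 y hy z hz i (by omega)

end Iterate

section BoundedDensity

variable {X : Type*} [PseudoEMetricSpace X] [MeasurableSpace X] [OpensMeasurableSpace X]
  {μ : Measure X} [IsFiniteMeasure μ] {f : X → X} {a : X → ℝ} {δ : ℝ≥0∞} {L τ : ℝ}

/-- On a small ball, the image under `f^[n]` of `μ` restricted to the points for which `n` is a
hyperbolic time has a density bounded independently of `n`: the inverse branches
have disjoint images, and each one distorts `μ` by a bounded factor. -/
lemma measure_isHypTime_inter_preimage_mul_le (hτ0 : 0 < τ) (hτ1 : τ < 1) (hL : 0 ≤ L)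
    (ha : ∀ x, 0 ≤ a x) (hδ0 : 0 < δ) (hδ : δ ≠ ⊤)
    (hpos : ∀ x r, 0 < r → μ (eball x r) ≠ 0)
    (hbr : ∀ x, ∃ g, IsBranch μ f (eball (f x) δ) x (τ⁻¹ * a x) L g)
    (hinj : ∀ x y, edist x y < δ → f x = f y → x = y)
    (n : ℕ) (p : X) {E : Set X} (hE : MeasurableSet E) (hEp : E ⊆ eball p (δ / 4)) :
    μ ({x | IsHypTime f a (τ ^ 2) x n} ∩ f^[n] ⁻¹' E) * μ (eball p (δ / 4)) ≤
      ENNReal.ofReal (Real.exp (L * (1 - τ)⁻¹ * δ.toReal)) * μ univ * μ E := by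
  set K := ENNReal.ofReal (Real.exp (L * (1 - τ)⁻¹ * δ.toReal)) with hK
  set B := eball p (δ / 4) with hBdef
  have hquart : 0 < δ / 4 := ENNReal.div_pos hδ0.ne' (by norm_num)
  have hhalf : δ / 4 + δ / 4 = δ / 2 := by
    rw [← ENNReal.add_div, ← two_mul, show (4 : ℝ≥0∞) = 2 * 2 by norm_num]
    exact ENNReal.mul_div_mul_left _ _ (by norm_num) (by norm_num)
  have hdist : ∀ y ∈ B, ∀ z ∈ B, edist y z < δ / 2 := by
    intro y hy z hz
    rw [← hhalf]
    exact (edist_triangle_right y z p).trans_lt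
      (ENNReal.add_lt_add (mem_eball.1 hy) (mem_eball.1 hz))
  have hBsub : ∀ x, f^[n] x ∈ B → B ⊆ eball (f^[n] x) δ := fun x hx y hy =>
    mem_eball.2 ((hdist y hy _ hx).trans_le ENNReal.half_le_self)
  have hdiam : ediam B ≤ ENNReal.ofReal δ.toReal := by
    rw [ENNReal.ofReal_toReal hδ]
    exact ediam_le fun y hy z hz => (hdist y hy z hz).le.trans ENNReal.half_le_self
  set H := {x | IsHypTime f a (τ ^ 2) x n} ∩ f^[n] ⁻¹' B with hH
  have hex := exists_isBranch_iterate hτ0 hτ1 hL ha hbr n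
  choose! G hG hGe using hex
  -- the distortion of the branches on `B` is at most `K`, whatever `n` and the base point
  have hunif : ∀ x ∈ H, ∃ c : ℝ≥0∞, c ≠ 0 ∧ ∀ E ⊆ B, MeasurableSet E →
      c * μ E ≤ μ (G x '' E) ∧ μ (G x '' E) ≤ K * (c * μ E) := by
    intro x hx
    obtain ⟨c, hc, h⟩ := (hG x hx.1).distortion B (hBsub x hx.2) δ.toReal ENNReal.toReal_nonneg
      hdiam
    refine ⟨c, hc, fun E hE hm => ⟨(h E hE hm).1, (h E hE hm).2.trans ?_⟩⟩
    rw [hK]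
    gcongr
    rw [← tsum_geometric_of_lt_one hτ0.le hτ1]
    exact (summable_geometric_of_lt_one hτ0.le hτ1).sum_le_tsum _ fun i _ => by positivity
  -- two branches whose images meet coincide: along the backward orbits they stay closer than `δ`,
  -- where `f` is injective
  have huniq : ∀ x ∈ H, ∀ x' ∈ H, ∀ y₁ ∈ B, ∀ y₂ ∈ B, G x y₁ = G x' y₂ →
      ∀ y ∈ B, G x y = G x' y := by
    intro x hx x' hx' y₁ hy₁ y₂ hy₂ heq y hy
    have e1 := hBsub x hx.2
    have e2 := hBsub x' hx'.2
    have hr1 := (hG x hx.1).right_inv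
    have hr2 := (hG x' hx'.1).right_inv
    obtain rfl : y₁ = y₂ := by
      rw [← hr1 y₁ (e1 hy₁), heq, hr2 y₂ (e2 hy₂)]
    have : ∀ k ≤ n, f^[n - k] (G x y) = f^[n - k] (G x' y) := by
      intro k
      induction k with
      | zero => intro _; simp [hr1 y (e1 hy), hr2 y (e2 hy)]
      | succ k ih =>
        intro hk
        apply hinj
        · calc edist (f^[n - (k + 1)] (G x y)) (f^[n - (k + 1)] (G x' y))
              ≤ edist (f^[n - (k + 1)] (G x y)) (f^[n - (k + 1)] (G x y₁)) +
                edist (f^[n - (k + 1)] (G x y₁)) (f^[n - (k + 1)] (G x' y)) := edist_triangle _ _ _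
            _ ≤ edist y y₁ + edist y₁ y := by
                gcongr
                · exact hGe x hx.1 y (e1 hy) y₁ (e1 hy₁) _ (by omega)
                · rw [heq]
                  exact hGe x' hx'.1 y₁ (e2 hy₁) y (e2 hy) _ (by omega)
            _ < δ / 2 + δ / 2 := ENNReal.add_lt_add (hdist y hy _ hy₁) (hdist _ hy₁ _ hy)
            _ = δ := ENNReal.add_halves δ
        · rw [← Function.iterate_succ_apply' f, ← Function.iterate_succ_apply' f,
            show (n - (k + 1)).succ = n - k by omega]
          exact ih (by omega)
    simpa using this n le_rfl
  have hpB : p ∈ B := mem_eball_self hquart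
  -- index the images by the corresponding preimages of the centre `p`
  let ι := {w : X // ∃ x ∈ H, G x p = w}
  choose x hxH hxp using fun w : ι => w.2
  let V : ι → Set X := fun w => G (x w) '' B
  have hVm : ∀ w, MeasurableSet (V w) := fun w =>
    (hG _ (hxH w).1).measurableSet_image B (hBsub _ (hxH w).2) isOpen_eball.measurableSet
  have hVd : Pairwise (Function.onFun Disjoint V) := by
    intro w w' hne
    refine disjoint_left.2 ?_
    rintro _ ⟨y₁, hy₁, rfl⟩ ⟨y₂, hy₂, h⟩
    apply hne
    apply Subtype.ext
    rw [← hxp w, ← hxp w']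
    exact huniq _ (hxH w) _ (hxH w') y₁ hy₁ y₂ hy₂ h.symm p hpB
  -- disjoint sets of positive measure in a finite measure space are countably many
  have hcount : Countable ι := by
    have h1 := Measure.countable_meas_pos_of_disjoint_iUnion (μ := μ) hVm hVd
    have h2 : {w | 0 < μ (V w)} = univ := by
      refine eq_univ_of_forall fun w => ?_
      obtain ⟨c, hc, h⟩ := hunif _ (hxH w)
      exact (pos_iff_ne_zero.2 (mul_ne_zero hc (hpos p _ hquart))).trans_le
        (h B Subset.rfl isOpen_eball.measurableSet).1
    rw [h2] at h1
    exact countable_univ_iff.1 h1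
  have hcover : {x | IsHypTime f a (τ ^ 2) x n} ∩ f^[n] ⁻¹' E ⊆ ⋃ w, G (x w) '' E := by
    rintro z ⟨hz, hzE⟩
    have hzH : z ∈ H := ⟨hz, hEp hzE⟩
    refine mem_iUnion.2 ⟨⟨G z p, z, hzH, rfl⟩, f^[n] z, hzE, ?_⟩
    rw [huniq _ (hxH _) z hzH p hpB p hpB (hxp _) _ (hEp hzE)]
    exact (hG z hz).apply_base
  calc μ ({x | IsHypTime f a (τ ^ 2) x n} ∩ f^[n] ⁻¹' E) * μ B
      ≤ (∑' w, μ (G (x w) '' E)) * μ B := by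
        gcongr
        exact (measure_mono hcover).trans (measure_iUnion_le _)
    _ = ∑' w, μ (G (x w) '' E) * μ B := ENNReal.tsum_mul_right.symm
    _ ≤ ∑' w, K * μ E * μ (V w) := by
        refine ENNReal.tsum_le_tsum fun w => ?_
        obtain ⟨c, hc, h⟩ := hunif _ (hxH w)
        calc μ (G (x w) '' E) * μ B ≤ K * (c * μ E) * μ B := by
              gcongr; exact (h E hEp hE).2
          _ = K * μ E * (c * μ B) := by ring
          _ ≤ K * μ E * μ (V w) := by
              gcongr; exact (h B Subset.rfl isOpen_eball.measurableSet).1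
    _ = K * μ E * ∑' w, μ (V w) := ENNReal.tsum_mul_left
    _ ≤ K * μ E * μ univ := by
        gcongr
        exact tsum_meas_le_meas_iUnion_of_disjoint μ hVm hVd |>.trans (measure_mono (subset_univ _))
    _ = _ := by ring

/-- The image under `f^[n]` of `μ` restricted to the points for which `n` is a hyperbolic time has
a density bounded by a constant independent of `n`. -/
lemma exists_measure_isHypTime_inter_preimage_le [CompactSpace X]
    (hτ0 : 0 < τ) (hτ1 : τ < 1) (hL : 0 ≤ L)
    (ha : ∀ x, 0 ≤ a x) (hδ0 : 0 < δ) (hδ : δ ≠ ⊤)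
    (hpos : ∀ x r, 0 < r → μ (eball x r) ≠ 0)
    (hbr : ∀ x, ∃ g, IsBranch μ f (eball (f x) δ) x (τ⁻¹ * a x) L g)
    (hinj : ∀ x y, edist x y < δ → f x = f y → x = y) :
    ∃ C : ℝ≥0∞, C ≠ ⊤ ∧ ∀ n (E : Set X), MeasurableSet E →
      μ ({x | IsHypTime f a (τ ^ 2) x n} ∩ f^[n] ⁻¹' E) ≤ C * μ E := by
  set K := ENNReal.ofReal (Real.exp (L * (1 - τ)⁻¹ * δ.toReal)) with hK
  have hquart : 0 < δ / 4 := ENNReal.div_pos hδ0.ne' (by norm_num)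
  obtain ⟨t, ht⟩ := isCompact_univ.elim_finite_subcover (fun p : X => eball p (δ / 4))
    (fun _ => isOpen_eball) (fun x _ => mem_iUnion.2 ⟨x, mem_eball_self hquart⟩)
  refine ⟨∑ p ∈ t, K * μ univ / μ (eball p (δ / 4)), ?_, fun n E hE => ?_⟩
  · refine ENNReal.sum_ne_top.2 fun p _ => ENNReal.div_ne_top ?_ (hpos p _ hquart)
    exact ENNReal.mul_ne_top ENNReal.ofReal_ne_top (measure_ne_top _ _)
  · have hsub : {x | IsHypTime f a (τ ^ 2) x n} ∩ f^[n] ⁻¹' E ⊆ ⋃ p ∈ t,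
        {x | IsHypTime f a (τ ^ 2) x n} ∩ f^[n] ⁻¹' (E ∩ eball p (δ / 4)) := by
      rintro x ⟨hx, hxE⟩
      obtain ⟨p, hp, hxp⟩ := mem_iUnion₂.1 (ht (mem_univ (f^[n] x)))
      exact mem_iUnion₂.2 ⟨p, hp, hx, hxE, hxp⟩
    refine (measure_mono hsub).trans ((measure_biUnion_finset_le _ _).trans ?_)
    rw [Finset.sum_mul]
    gcongr with p hp
    have := measure_isHypTime_inter_preimage_mul_le hτ0 hτ1 hL ha hδ0 hδ hpos hbr hinj n p
      (hE.inter isOpen_eball.measurableSet) inter_subset_right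
    rw [← ENNReal.le_div_iff_mul_le (Or.inl (hpos p _ hquart)) (Or.inl (measure_ne_top _ _))]
      at this
    refine this.trans ?_
    rw [ENNReal.mul_div_right_comm]
    exact mul_le_mul_right (measure_mono inter_subset_left) _

end BoundedDensity

/-! ### A finite measure dominating all push-forwards -/

/-- The set of points without a `σ`-hyperbolic time in `{1, …, k}`. -/
def noHypTime {X : Type*} (f : X → X) (a : X → ℝ) (σ : ℝ) (k : ℕ) : Set X :=
  {x | ∀ n ≤ k, ¬ IsHypTime f a σ x n}

section Domination

variable {X : Type*} {f : X → X} {a : X → ℝ} {σ : ℝ}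

/-- Splitting according to the last hyperbolic time `i ≤ j` of the orbit (or `i = 0`): from then on,
the orbit of `f^[i] x` has no hyperbolic time up to `j - i`. -/
lemma preimage_iterate_subset (ha : ∀ x, 0 ≤ a x) (hσ : 0 ≤ σ) (j : ℕ) (E : Set X) :
    f^[j] ⁻¹' E ⊆ ⋃ i ∈ Finset.range (j + 1), {x | i = 0 ∨ IsHypTime f a σ x i} ∩
      f^[i] ⁻¹' (noHypTime f a σ (j - i) ∩ f^[j - i] ⁻¹' E) := by
  classical
  intro x hx
  let P : ℕ → Prop := fun i => i = 0 ∨ IsHypTime f a σ x i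
  have h0 : P 0 := Or.inl rfl
  set i := Nat.findGreatest P j with hi
  have hij : i ≤ j := Nat.findGreatest_le j
  have hPi : P i := Nat.findGreatest_spec (Nat.zero_le j) h0
  refine mem_iUnion₂.2 ⟨i, Finset.mem_range.2 (by omega), hPi, ?_, ?_⟩
  · intro n hn hyp
    have hPn : P (i + n) := by
      refine Or.inr ?_
      rcases hPi with h | h
      · rw [h] at hyp ⊢
        simpa using hyp
      · exact h.add ha hσ hyp
    have := Nat.le_findGreatest (show i + n ≤ j by omega) hPn
    have := hyp.1
    omega
  · change f^[j - i] (f^[i] x) ∈ E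
    rw [← Function.iterate_add_apply, Nat.sub_add_cancel hij]
    exact hx

variable [MeasurableSpace X] {μ : Measure X}

lemma measurableSet_noHypTime [TopologicalSpace X] [OpensMeasurableSpace X]
    (hf : Continuous f) (ha : Continuous a) (k : ℕ) : MeasurableSet (noHypTime f a σ k) := by
  simp only [noHypTime, ofPred_forall]
  exact MeasurableSet.iInter fun n => MeasurableSet.iInter fun _ =>
    (isClosed_setOf_isHypTime hf ha n).measurableSet.compl

/-- If the first hyperbolic time is integrable, the measures of the sets `noHypTime f a σ k` are
summable, as their sum is the integral of the first hyperbolic time. -/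
lemma tsum_measure_noHypTime_ne_top [TopologicalSpace X] [OpensMeasurableSpace X]
    (hf : Continuous f) (hac : Continuous a)
    (hdef : ∀ᵐ x ∂μ, ∃ n, IsHypTime f a σ x n)
    (hint : Integrable (fun x => ((sInf {n | IsHypTime f a σ x n} : ℕ) : ℝ)) μ) :
    ∑' k, μ (noHypTime f a σ k) ≠ ⊤ := by
  have h1 : ∑' k, μ (noHypTime f a σ k) =
      ∫⁻ x, ∑' k, (noHypTime f a σ k).indicator 1 x ∂μ := by
    rw [lintegral_tsum fun k =>
      (measurable_one.indicator (measurableSet_noHypTime hf hac k)).aemeasurable]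
    exact tsum_congr fun k => (lintegral_indicator_one (measurableSet_noHypTime hf hac k)).symm
  rw [h1]
  refine ((lintegral_mono_ae ?_).trans_lt hint.lintegral_lt_top).ne
  filter_upwards [hdef] with x hx
  have hmem : IsHypTime f a σ x (sInf {n | IsHypTime f a σ x n}) := Nat.sInf_mem hx
  set h := sInf {n | IsHypTime f a σ x n}
  rw [tsum_eq_sum (s := Finset.range h)]
  · refine (Finset.sum_le_sum fun k _ => (indicator_le_self' (by simp) x :
      (noHypTime f a σ k).indicator (1 : X → ℝ≥0∞) x ≤ 1)).trans ?_
    simp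
  · intro k hk
    refine indicator_of_notMem (fun hxk => ?_) _
    exact (hxk : ∀ n ≤ k, ¬ IsHypTime f a σ x n) h (by simpa using hk) hmem

/-- If the first hyperbolic time is integrable, the push-forwards of `μ` under all iterates are
dominated by a single finite measure, absolutely continuous with respect to `μ`. -/
lemma exists_dominating_measure [TopologicalSpace X] [BorelSpace X]
    (hf : Continuous f) (hac : Continuous a)
    (ha : ∀ x, 0 ≤ a x) (hσ : 0 ≤ σ) {C : ℝ≥0∞} (hC : C ≠ ⊤)
    (hns : ∀ E, MeasurableSet E → μ E = 0 → μ (f ⁻¹' E) = 0)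
    (hbound : ∀ n (E : Set X), MeasurableSet E →
      μ ({x | IsHypTime f a σ x n} ∩ f^[n] ⁻¹' E) ≤ C * μ E)
    (hdef : ∀ᵐ x ∂μ, ∃ n, IsHypTime f a σ x n)
    (hint : Integrable (fun x => ((sInf {n | IsHypTime f a σ x n} : ℕ) : ℝ)) μ) :
    ∃ ν : Measure X, IsFiniteMeasure ν ∧ ν ≪ μ ∧
      ∀ j (E : Set X), MeasurableSet E → μ (f^[j] ⁻¹' E) ≤ ν E := by
  have hfm : ∀ j, Measurable f^[j] := fun j => hf.measurable.iterate j
  have hN := fun k => measurableSet_noHypTime (σ := σ) hf hac k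
  let ν : Measure X := Measure.sum fun k => (C + 1) • (μ.restrict (noHypTime f a σ k)).map f^[k]
  have hν : ∀ E, MeasurableSet E →
      ν E = ∑' k, (C + 1) * μ (noHypTime f a σ k ∩ f^[k] ⁻¹' E) := by
    intro E hE
    rw [Measure.sum_apply _ hE]
    refine tsum_congr fun k => ?_
    rw [Measure.smul_apply, Measure.map_apply (hfm k) hE, Measure.restrict_apply ((hfm k) hE),
      smul_eq_mul, inter_comm]
  refine ⟨ν, ⟨?_⟩, ?_, fun j E hE => ?_⟩
  · rw [hν _ MeasurableSet.univ, ENNReal.tsum_mul_left]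
    refine ENNReal.mul_lt_top (by simp [hC.lt_top]) ?_
    simpa using (tsum_measure_noHypTime_ne_top hf hac hdef hint).lt_top
  · refine Measure.AbsolutelyContinuous.mk fun E hE hE0 => ?_
    have hit : ∀ k, μ (f^[k] ⁻¹' E) = 0 := by
      intro k
      induction k with
      | zero => simpa using hE0
      | succ k ih =>
        rw [Function.iterate_succ, preimage_comp]
        exact hns _ ((hfm k) hE) ih
    rw [hν E hE]
    simp only [ENNReal.tsum_eq_zero]
    intro k
    rw [measure_mono_null inter_subset_right (hit k), mul_zero]
  · refine (measure_mono (preimage_iterate_subset ha hσ j E)).trans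
      ((measure_biUnion_finset_le _ _).trans ?_)
    have hm : ∀ k, MeasurableSet (noHypTime f a σ k ∩ f^[k] ⁻¹' E) := fun k =>
      (hN k).inter ((hfm k) hE)
    calc ∑ i ∈ Finset.range (j + 1), μ ({x | i = 0 ∨ IsHypTime f a σ x i} ∩
          f^[i] ⁻¹' (noHypTime f a σ (j - i) ∩ f^[j - i] ⁻¹' E))
        ≤ ∑ i ∈ Finset.range (j + 1),
          (C + 1) * μ (noHypTime f a σ (j - i) ∩ f^[j - i] ⁻¹' E) := by
          refine Finset.sum_le_sum fun i _ => ?_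
          rcases Nat.eq_zero_or_pos i with rfl | hi
          · simpa using le_mul_of_one_le_left (zero_le (a := μ _)) (le_add_self (a := (1 : ℝ≥0∞)))
          · have : {x | i = 0 ∨ IsHypTime f a σ x i} = {x | IsHypTime f a σ x i} := by
              ext x; simp [hi.ne']
            rw [this]
            exact (hbound i _ (hm _)).trans (by gcongr; exact le_self_add)
      _ = ∑ k ∈ Finset.range (j + 1), (C + 1) * μ (noHypTime f a σ k ∩ f^[k] ⁻¹' E) :=
          Finset.sum_range_reflect
            (fun k => (C + 1) * μ (noHypTime f a σ k ∩ f^[k] ⁻¹' E)) (j + 1)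
      _ ≤ ν E := by
          rw [hν E hE]
          exact ENNReal.sum_le_tsum _

end Domination

/-! ### Asymptotic averages along orbits -/

section Averages

variable {X : Type*} {f : X → X}

lemma birkhoffSum_le_mul {u : X → ℝ} {A : ℝ} (hu : ∀ x, u x ≤ A) (n : ℕ) (x : X) :
    birkhoffSum f u n x ≤ A * n := by
  rw [birkhoffSum]
  refine (Finset.sum_le_card_nsmul _ _ A fun j _ => hu _).trans ?_
  simp [mul_comm]

/-- If from every point of the orbit of `x` outside `E` one can advance by at most `N` steps with a
nonpositive sum of `u`, then only the visits to `E`, and the last `N` steps, contribute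
to the sum of `u`. -/
lemma birkhoffSum_le_of_forall_notMem {u : X → ℝ} {A : ℝ} (hA : 0 ≤ A) (hu : ∀ x, u x ≤ A)
    {E : Set X} {N : ℕ} (n : ℕ) : ∀ x : X,
    (∀ j, f^[j] x ∉ E → ∃ m, 1 ≤ m ∧ m ≤ N ∧ birkhoffSum f u m (f^[j] x) ≤ 0) →
    birkhoffSum f u n x ≤ A * (birkhoffSum f (E.indicator 1) n x + N) := by
  induction n using Nat.strong_induction_on with
  | _ n ih =>
  intro x h
  have hvis : ∀ m y, (0 : ℝ) ≤ birkhoffSum f (E.indicator 1) m y := fun m y =>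
    Finset.sum_nonneg fun _ _ => indicator_nonneg (fun _ _ => zero_le_one) _
  have hshift : ∀ k j, f^[j] (f^[k] x) ∉ E →
      ∃ m, 1 ≤ m ∧ m ≤ N ∧ birkhoffSum f u m (f^[j] (f^[k] x)) ≤ 0 := by
    intro k j hj
    rw [← Function.iterate_add_apply] at hj ⊢
    exact h _ hj
  rcases le_or_gt n N with hn | hn
  · refine (birkhoffSum_le_mul hu n x).trans ?_
    have : (n : ℝ) ≤ N := by exact_mod_cast hn
    have := hvis n x
    gcongr
    linarith
  · by_cases hx : x ∈ E
    · obtain ⟨n, rfl⟩ : ∃ k, n = k + 1 := ⟨n - 1, by omega⟩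
      rw [birkhoffSum_succ', birkhoffSum_succ']
      have := ih n (by omega) (f x) (by simpa using hshift 1)
      simp only [indicator_of_mem hx, Pi.one_apply]
      linarith [hu x]
    · obtain ⟨m, hm1, hmN, hm⟩ := h 0 hx
      obtain ⟨k, rfl⟩ : ∃ k, n = m + k := ⟨n - m, by omega⟩
      rw [birkhoffSum_add, birkhoffSum_add]
      have := ih k (by omega) (f^[m] x) (hshift m)
      have h0 := mul_nonneg hA (hvis m x)
      simp only [Function.iterate_zero, id_eq] at hm
      linarith

/-- The orbit points of a point with infinitely many averages above `c` all have some average at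
least `c' < c`, as the initial segment of the orbit does not matter in the limit. -/
lemma exists_le_birkhoffSum_iterate {u : X → ℝ} {A c c' : ℝ} (hu : ∀ x, u x ≤ A) (hc : c' < c)
    {x : X} (hx : ∃ᶠ n : ℕ in atTop, c * n < birkhoffSum f u n x) (j : ℕ) :
    ∃ m, 1 ≤ m ∧ c' * m ≤ birkhoffSum f u m (f^[j] x) := by
  obtain ⟨M, hM⟩ := exists_nat_gt ((A * j - c' * j) / (c - c'))
  rw [div_lt_iff₀ (sub_pos.2 hc)] at hM
  obtain ⟨n, hn, hnM⟩ := (hx.and_eventually (eventually_ge_atTop (M + j + 1))).exists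
  obtain ⟨m, rfl⟩ : ∃ m, n = j + m := ⟨n - j, by omega⟩
  refine ⟨m, by omega, ?_⟩
  rw [birkhoffSum_add] at hn
  have h1 := birkhoffSum_le_mul (f := f) hu j x
  have h2 : (M : ℝ) ≤ (j + m : ℕ) := by exact_mod_cast (by omega : M ≤ j + m)
  have h3 := mul_le_mul_of_nonneg_right h2 (sub_pos.2 hc).le
  push_cast at h3 hn
  nlinarith

/-- The points whose orbit has to be followed for more than `N` steps to see averages of `u` on both
sides: either no average over at most `N` steps is at most `b`, or some average is at least `c` but
none over at most `N` steps is. -/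
def lateSet (f : X → X) (u : X → ℝ) (b c : ℝ) (N : ℕ) : Set X :=
  {y | ∀ n, 1 ≤ n → n ≤ N → ¬ birkhoffSum f u n y ≤ b * n} ∪
  {y | (∃ n, 1 ≤ n ∧ c * n ≤ birkhoffSum f u n y) ∧
    ∀ n, 1 ≤ n → n ≤ N → ¬ c * n ≤ birkhoffSum f u n y}

lemma antitone_lateSet (u : X → ℝ) (b c : ℝ) : Antitone (lateSet f u b c) := by
  intro M N hMN
  rintro y (hy | hy)
  · exact Or.inl fun n h1 h2 => hy n h1 (h2.trans hMN)
  · exact Or.inr ⟨hy.1, fun n h1 h2 => hy.2 n h1 (h2.trans hMN)⟩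

lemma iInter_lateSet_subset (u : X → ℝ) (b c : ℝ) :
    ⋂ N, lateSet f u b c N ⊆ {y | ¬ ∃ n, 1 ≤ n ∧ birkhoffSum f u n y ≤ b * n} := by
  rintro y hy ⟨n, hn, hle⟩
  have hy' := mem_iInter.1 hy
  rcases hy' n with h | ⟨⟨m, hm, hmle⟩, -⟩
  · exact h n hn le_rfl hle
  · rcases hy' (max n m) with h | h
    · exact h n hn (le_max_left _ _) hle
    · exact h.2 m hm (le_max_right _ _) hmle

variable [MeasurableSpace X] {μ ν : Measure X}

lemma measurable_birkhoffSum (hf : Measurable f) {u : X → ℝ} (hu : Measurable u) (n : ℕ) :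
    Measurable (birkhoffSum f u n) :=
  Finset.measurable_sum _ fun j _ => hu.comp (hf.iterate j)

lemma measurableSet_lateSet (hf : Measurable f) {u : X → ℝ} (hu : Measurable u) (b c : ℝ)
    (N : ℕ) : MeasurableSet (lateSet f u b c N) := by
  have hb := measurable_birkhoffSum hf hu
  have h1 : ∀ n : ℕ, MeasurableSet {y | birkhoffSum f u n y ≤ b * n} := fun n =>
    measurableSet_le (hb n) measurable_const
  have h2 : ∀ n : ℕ, MeasurableSet {y | c * n ≤ birkhoffSum f u n y} := fun n =>
    measurableSet_le measurable_const (hb n)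
  have h3 : ∀ P : ℕ → X → Prop, (∀ n, MeasurableSet {y | P n y}) →
      MeasurableSet {y | ∀ n, 1 ≤ n → n ≤ N → ¬ P n y} := by
    intro P hP
    simp only [ofPred_forall]
    exact MeasurableSet.iInter fun n => MeasurableSet.iInter fun _ => MeasurableSet.iInter fun _ =>
      (hP n).compl
  have h4 : MeasurableSet {y | ∃ n, 1 ≤ n ∧ c * n ≤ birkhoffSum f u n y} := by
    simp only [ofPred_exists]
    exact MeasurableSet.iUnion fun n => (MeasurableSet.const _).inter (h2 n)
  exact (h3 _ h1).union (h4.inter (h3 _ h2))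

/-- A one-sided ergodic theorem without an invariant measure. Suppose that the push-forwards of `μ`
under all iterates are dominated by a finite measure `ν ≪ μ`. If almost every point has an average
at most `b` of `u`, then the averages of `u` are eventually below any `c > b`.
On the points with infinitely many averages above `c`, an orbit segment can be cut into blocks with
average at most `b`, and also into blocks with average at least some `c' > b`, up to the visits to
a set of small `ν`-measure. -/
lemma ae_eventually_birkhoffSum_le [IsFiniteMeasure μ] [IsFiniteMeasure ν] (hf : Measurable f)
    (hνμ : ν ≪ μ) (hν : ∀ j (E : Set X), MeasurableSet E → μ (f^[j] ⁻¹' E) ≤ ν E)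
    {u : X → ℝ} (hu : Measurable u) {A b c : ℝ} (huA : ∀ x, |u x| ≤ A) (hbc : b < c)
    (hb : ∀ᵐ x ∂μ, ∃ n, 1 ≤ n ∧ birkhoffSum f u n x ≤ b * n) :
    ∀ᵐ x ∂μ, ∀ᶠ n : ℕ in atTop, birkhoffSum f u n x ≤ c * n := by
  obtain ⟨c', hbc', hcc'⟩ := exists_between hbc
  let B : Set X := {x | ∃ᶠ n : ℕ in atTop, c * n < birkhoffSum f u n x}
  have hBm : MeasurableSet B := by
    have : B = ⋂ N : ℕ, ⋃ n : ℕ, ⋃ _ : N ≤ n, {x | c * n < birkhoffSum f u n x} := by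
      ext x
      simp [B, frequently_atTop]
    rw [this]
    exact MeasurableSet.iInter fun N => MeasurableSet.iUnion fun n => MeasurableSet.iUnion fun _ =>
      measurableSet_lt measurable_const (measurable_birkhoffSum hf hu n)
  suffices h0 : μ B = 0 by
    refine measure_mono_null (fun x hx => ?_) h0
    exact (not_eventually.1 hx).mono fun n hn => not_le.1 hn
  set A' : ℝ := A + |b| + |c'| with hA'
  have hEm := measurableSet_lateSet hf hu b c'
  have hA0 : ∀ x : X, 0 ≤ A := fun x => (abs_nonneg _).trans (huA x)
  by_contra hB0
  obtain ⟨x₀, -⟩ : B.Nonempty := nonempty_of_measure_ne_zero hB0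
  have hA'0 : 0 ≤ A' := by have := hA0 x₀; positivity
  -- the pointwise estimate, obtained by comparing the two ways to cut the orbit
  have hpt : ∀ N L : ℕ, ∀ x ∈ B, (c' - b) * L ≤
      2 * A' * (birkhoffSum f ((lateSet f u b c' N).indicator 1) L x + N) := by
    intro N L x hx
    have h1 := birkhoffSum_le_of_forall_notMem (f := f) (u := fun y => u y - b) hA'0
      (fun y => by have := le_abs_self (u y); have := huA y; have := neg_abs_le b
                   have := abs_nonneg c'; linarith)
      (E := lateSet f u b c' N) (N := N) L x (by
        intro j hj
        obtain ⟨n, hn1, hnN, hn⟩ : ∃ n, 1 ≤ n ∧ n ≤ N ∧ birkhoffSum f u n (f^[j] x) ≤ b * n := by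
          by_contra! hcon
          exact hj (Or.inl fun n h1 h2 => not_le.2 (hcon n h1 h2))
        refine ⟨n, hn1, hnN, ?_⟩
        have : birkhoffSum f (fun y => u y - b) n (f^[j] x) =
            birkhoffSum f u n (f^[j] x) - b * n := by simp [birkhoffSum, mul_comm]
        linarith)
    have h2 := birkhoffSum_le_of_forall_notMem (f := f) (u := fun y => c' - u y) hA'0
      (fun y => by have := neg_abs_le (u y); have := huA y; have := le_abs_self c'
                   have := abs_nonneg b; linarith)
      (E := lateSet f u b c' N) (N := N) L x (by
        intro j hj
        obtain ⟨n, hn1, hnN, hn⟩ : ∃ n, 1 ≤ n ∧ n ≤ N ∧ c' * n ≤ birkhoffSum f u n (f^[j] x) := by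
          by_contra! hcon
          exact hj (Or.inr ⟨exists_le_birkhoffSum_iterate
            (fun y => (le_abs_self _).trans (huA y)) hcc' hx j,
            fun n h1 h2 => not_le.2 (hcon n h1 h2)⟩)
        refine ⟨n, hn1, hnN, ?_⟩
        have : birkhoffSum f (fun y => c' - u y) n (f^[j] x) =
            c' * n - birkhoffSum f u n (f^[j] x) := by simp [birkhoffSum, mul_comm]
        linarith)
    have e1 : birkhoffSum f (fun y => u y - b) L x + birkhoffSum f (fun y => c' - u y) L x =
        (c' - b) * L := by
      simp [birkhoffSum]
      ring
    linarith
  have hbB : 0 < μ.real B := ENNReal.toReal_pos hB0 (measure_ne_top _ _)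
  have hintegral : ∀ N L : ℕ, (c' - b) * L * μ.real B ≤
      2 * A' * (L * ν.real (lateSet f u b c' N) + N * μ.real B) := by
    intro N L
    set E := lateSet f u b c' N with hE
    have hi : ∀ j, Integrable (fun x => E.indicator (1 : X → ℝ) (f^[j] x)) (μ.restrict B) := by
      intro j
      have : (fun x => E.indicator (1 : X → ℝ) (f^[j] x)) = (f^[j] ⁻¹' E).indicator 1 := rfl
      rw [this]
      exact (integrable_const (1 : ℝ)).indicator ((hf.iterate j) (hEm N))
    have hV : ∫ x in B, birkhoffSum f (E.indicator 1) L x ∂μ ≤ L * ν.real E := by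
      simp only [birkhoffSum]
      rw [integral_finsetSum _ fun j _ => hi j]
      refine (Finset.sum_le_card_nsmul _ _ (ν.real E) fun j _ => ?_).trans (by simp)
      have : (fun x => E.indicator (1 : X → ℝ) (f^[j] x)) = (f^[j] ⁻¹' E).indicator 1 := rfl
      rw [this, integral_indicator_one ((hf.iterate j) (hEm N))]
      refine ENNReal.toReal_mono (measure_ne_top _ _) ?_
      exact (Measure.restrict_apply_le _ _).trans (hν j E (hEm N))
    have hiV : Integrable (fun x => birkhoffSum f (E.indicator (1 : X → ℝ)) L x)
        (μ.restrict B) := by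
      simp only [birkhoffSum]
      exact integrable_finsetSum _ fun j _ => hi j
    have hmono := setIntegral_mono_on (μ := μ) (s := B) (f := fun _ => (c' - b) * L)
      (g := fun x => 2 * A' * (birkhoffSum f (E.indicator 1) L x + N))
      (integrable_const _) ((hiV.add (integrable_const _)).const_mul _) hBm (hpt N L)
    rw [setIntegral_const, integral_const_mul, integral_add hiV (integrable_const _),
      setIntegral_const] at hmono
    simp only [smul_eq_mul] at hmono
    calc (c' - b) * L * μ.real B = μ.real B * ((c' - b) * L) := by ring
      _ ≤ _ := hmono
      _ ≤ 2 * A' * (L * ν.real E + μ.real B * N) := by gcongr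
      _ = _ := by ring
  -- divide by `L` and let `L` tend to infinity
  have hlim : ∀ N : ℕ, (c' - b) * μ.real B ≤ 2 * A' * ν.real (lateSet f u b c' N) := by
    intro N
    by_contra! hlt
    obtain ⟨L, hL⟩ := exists_nat_gt ((2 * A' * (N * μ.real B)) /
      ((c' - b) * μ.real B - 2 * A' * ν.real (lateSet f u b c' N)))
    rw [div_lt_iff₀ (sub_pos.2 hlt)] at hL
    have := hintegral N L
    nlinarith
  have htend : Tendsto (fun N => ν (lateSet f u b c' N)) atTop (𝓝 0) := by
    have h1 := tendsto_measure_iInter_atTop (μ := ν)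
      (fun N => (hEm N).nullMeasurableSet) (antitone_lateSet (f := f) u b c')
      ⟨0, measure_ne_top _ _⟩
    rwa [measure_mono_null (iInter_lateSet_subset u b c') (hνμ hb)] at h1
  have htend' : Tendsto (fun N => 2 * A' * ν.real (lateSet f u b c' N)) atTop (𝓝 0) := by
    have := ((ENNReal.tendsto_toReal ENNReal.zero_ne_top).comp htend).const_mul (2 * A')
    simpa [Measure.real] using this
  have := ge_of_tendsto' htend' hlim
  have := mul_pos (sub_pos.2 hbc') hbB
  linarith

end Averages

/-! ### Pliss's lemma and the frequency of hyperbolic times -/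

/-- **Pliss's lemma**: if `b` is bounded above by `A` and its first `N` terms have average at least
`c₂ > c₁`, then a proportion at least `(c₂ - c₁) / (A - c₁)` of the times `i ≤ N` are such that
all averages of `b` over blocks ending at `i` are at least `c₁`. These are the record times
of the partial sums of `b - c₁`. -/
lemma exists_finset_pliss {b : ℕ → ℝ} {A c₁ c₂ : ℝ} (hb : ∀ j, b j ≤ A) (h₁ : c₁ < A) (N : ℕ)
    (hN : c₂ * N ≤ ∑ j ∈ Finset.range N, b j) :
    ∃ s : Finset ℕ, (∀ i ∈ s, 1 ≤ i ∧ i ≤ N ∧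
      ∀ k, 1 ≤ k → k ≤ i → c₁ * k ≤ ∑ j ∈ Finset.Ico (i - k) i, b j) ∧
      (c₂ - c₁) / (A - c₁) * N ≤ s.card := by
  classical
  -- `R n` is the set of record times up to `n`; the running maximum of `T`, which starts at `0`,
  -- changes only at record times, by at most `A - c₁` each time
  let T : ℕ → ℝ := fun n => ∑ j ∈ Finset.range n, (b j - c₁)
  let R : ℕ → Finset ℕ := fun n => (Finset.Icc 1 n).filter fun i => ∀ m < i, T m ≤ T i
  have hA : 0 < A - c₁ := sub_pos.2 h₁
  have hmax : ∀ n, ∀ m ≤ n, T m ≤ (A - c₁) * (R n).card := by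
    intro n
    induction n with
    | zero =>
      intro m hm
      obtain rfl : m = 0 := by omega
      simp [T, R]
    | succ n ih =>
      have hsub : R n ⊆ R (n + 1) := by
        intro i hi
        simp only [R, Finset.mem_filter, Finset.mem_Icc] at hi ⊢
        exact ⟨⟨hi.1.1, by omega⟩, hi.2⟩
      have hcard : ((R n).card : ℝ) ≤ (R (n + 1)).card := by
        exact_mod_cast Finset.card_le_card hsub
      have hle : ∀ m ≤ n, T m ≤ (A - c₁) * (R (n + 1)).card := fun m hm =>
        (ih m hm).trans (by gcongr)
      intro m hm
      rcases Nat.lt_or_ge n m with hlt | hge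
      · obtain rfl : m = n + 1 := by omega
        by_cases hrec : ∀ m < n + 1, T m ≤ T (n + 1)
        · have hmem : n + 1 ∉ R n := by simp [R]
          have hins : insert (n + 1) (R n) ⊆ R (n + 1) := by
            refine Finset.insert_subset ?_ hsub
            simpa [R] using fun m hm => hrec m (by omega)
          have hc := Finset.card_le_card hins
          rw [Finset.card_insert_of_notMem hmem] at hc
          have hc' : ((R n).card : ℝ) + 1 ≤ (R (n + 1)).card := by exact_mod_cast hc
          have hT : T (n + 1) = T n + (b n - c₁) := Finset.sum_range_succ _ _
          have := ih n le_rfl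
          have := hb n
          nlinarith
        · push Not at hrec
          obtain ⟨k, hk, hlt⟩ := hrec
          exact hlt.le.trans (hle k (by omega))
      · exact hle m hge
  refine ⟨R N, fun i hi => ?_, ?_⟩
  · simp only [R, Finset.mem_filter, Finset.mem_Icc] at hi
    refine ⟨hi.1.1, hi.1.2, fun k hk hki => ?_⟩
    have h := hi.2 (i - k) (by omega)
    have hs : T i - T (i - k) = ∑ j ∈ Finset.Ico (i - k) i, (b j - c₁) := by
      rw [Finset.sum_Ico_eq_sub _ (by omega : i - k ≤ i)]
    rw [Finset.sum_sub_distrib, Finset.sum_const, Nat.card_Ico, nsmul_eq_mul,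
      show i - (i - k) = k by omega] at hs
    linarith
  · have h := hmax N N le_rfl
    have hT : T N = ∑ j ∈ Finset.range N, b j - c₁ * N := by
      simp [T, Finset.sum_sub_distrib, mul_comm]
    rw [div_mul_eq_mul_div, div_le_iff₀ hA]
    linarith

section Frequency

variable {X : Type*} {f : X → X} {a : X → ℝ}

/-- Pliss's lemma for the negative logarithm of the weight along an orbit. -/
lemma exists_finset_isHypTime (ha : ∀ x, 0 < a x) {A c₁ c₂ : ℝ} (hA : ∀ x, -Real.log (a x) ≤ A)
    (h₁ : c₁ < A) (x : X) (N : ℕ)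
    (hN : birkhoffSum f (fun y => Real.log (a y)) N x ≤ -c₂ * N) :
    ∃ s : Finset ℕ, (∀ i ∈ s, i ≤ N ∧ IsHypTime f a (Real.exp (-c₁)) x i) ∧
      (c₂ - c₁) / (A - c₁) * N ≤ s.card := by
  obtain ⟨s, hs, hcard⟩ := exists_finset_pliss (c₂ := c₂) (b := fun j => -Real.log (a (f^[j] x)))
    (fun j => hA _) h₁ N (by
      rw [Finset.sum_neg_distrib]
      rw [birkhoffSum] at hN
      linarith)
  refine ⟨s, fun i hi => ?_, hcard⟩
  obtain ⟨h1, h2, h3⟩ := hs i hi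
  refine ⟨h2, h1, fun k hk hki => ?_⟩
  have h := h3 k hk hki
  have hpos : 0 < ∏ j ∈ Finset.Ico (i - k) i, a (f^[j] x) := Finset.prod_pos fun _ _ => ha _
  rw [← Real.exp_nat_mul, ← Real.log_le_iff_le_exp hpos, Real.log_prod fun j _ => (ha _).ne']
  rw [Finset.sum_neg_distrib] at h
  linarith

/-- Domination of the push-forwards and existence of hyperbolic times at almost every point yield
a uniform positive frequency of hyperbolic times, for a weaker rate. -/
lemma exists_frequency_isHypTime [MeasurableSpace X] [TopologicalSpace X] [CompactSpace X]
    [BorelSpace X] {μ ν : Measure X} [IsFiniteMeasure μ] [IsFiniteMeasure ν]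
    (hf : Continuous f) (hac : Continuous a) (ha : ∀ x, 0 < a x)
    (hνμ : ν ≪ μ) (hν : ∀ j (E : Set X), MeasurableSet E → μ (f^[j] ⁻¹' E) ≤ ν E)
    {σ : ℝ} (hσ0 : 0 < σ) (hσ1 : σ < 1) (hdef : ∀ᵐ x ∂μ, ∃ n, IsHypTime f a σ x n) :
    ∃ σ' θ : ℝ, 0 < σ' ∧ σ' < 1 ∧ 0 < θ ∧ ∀ᵐ x ∂μ, ∀ᶠ n : ℕ in atTop,
      ∃ s : Finset ℕ, (∀ i ∈ s, i ≤ n ∧ IsHypTime f a σ' x i) ∧ θ * (n : ℝ) ≤ (s.card : ℝ) := by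
  have hlog : Real.log σ < 0 := Real.log_neg hσ0 hσ1
  have hcont : Continuous fun x => Real.log (a x) := hac.log fun x => (ha x).ne'
  obtain ⟨A, hA⟩ : ∃ A : ℝ, ∀ x, |Real.log (a x)| ≤ A := by
    obtain ⟨A, hA⟩ := (isCompact_range hcont.abs).bddAbove
    exact ⟨A, fun x => hA ⟨x, rfl⟩⟩
  have hae := ae_eventually_birkhoffSum_le (c := Real.log σ / 2) hf.measurable hνμ hν
    hcont.measurable hA (by linarith) (b := Real.log σ) (by
      filter_upwards [hdef] with x hx
      obtain ⟨n, hn⟩ := hx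
      refine ⟨n, hn.1, ?_⟩
      have hpos : 0 < ∏ j ∈ Finset.range n, a (f^[j] x) := Finset.prod_pos fun _ _ => ha _
      have := Real.log_le_log hpos hn.prod_range_le
      rw [Real.log_pow, Real.log_prod fun j _ => (ha _).ne'] at this
      rw [birkhoffSum]
      linarith)
  -- Pliss's lemma with `c₂ = -log σ / 2` and `c₁ = -log σ / 4`, which has to be smaller than the
  -- upper bound `A'`
  set A' := max A (-Real.log σ) with hA'
  have hlt : -(Real.log σ / 4) < A' := lt_of_lt_of_le (by linarith) (le_max_right _ _)
  refine ⟨Real.exp (-(-(Real.log σ / 4))),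
    (-(Real.log σ / 2) - -(Real.log σ / 4)) / (A' - -(Real.log σ / 4)),
    Real.exp_pos _, Real.exp_lt_one_iff.2 (by linarith), div_pos (by linarith) (by linarith), ?_⟩
  filter_upwards [hae] with x hx
  filter_upwards [hx] with n hn
  exact exists_finset_isHypTime ha
    (fun y => (neg_le_abs _).trans ((hA y).trans (le_max_left _ _))) hlt x n (by linarith)

end Frequency

/-! ### Derivatives and the Riemannian distance -/

/-- Two real functions whose ratio tends to `1` have the same limits. -/
lemma tendsto_of_eventually_le_mul {α : Type*} {l : Filter α} {u w : α → ℝ} {v : ℝ}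
    (hw : Tendsto w l (𝓝 v))
    (h : ∀ r : ℝ, 1 < r → ∀ᶠ y in l, u y ≤ r * w y ∧ w y ≤ r * u y) : Tendsto u l (𝓝 v) := by
  have hexists : ∀ p q : ℝ, p < q → ∃ r : ℝ, 1 < r ∧ r * p < q := by
    intro p q hpq
    have h1 : ∀ᶠ r : ℝ in 𝓝 1, r * p < q := by
      have : Tendsto (fun r : ℝ => r * p) (𝓝 1) (𝓝 (1 * p)) := tendsto_id.mul_const p
      rw [one_mul] at this
      exact this.eventually (gt_mem_nhds hpq)
    obtain ⟨r, hr, hr1⟩ := ((h1.filter_mono nhdsWithin_le_nhds).and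
      (self_mem_nhdsWithin (s := Ioi (1 : ℝ)))).exists
    exact ⟨r, hr1, hr⟩
  refine tendsto_order.2 ⟨fun a ha => ?_, fun b hb => ?_⟩
  · obtain ⟨r, hr1, hr⟩ := hexists a v ha
    filter_upwards [hw.eventually (lt_mem_nhds hr), h r hr1] with y hy1 hy2
    exact lt_of_mul_lt_mul_left (hy1.trans_le hy2.2) (by linarith)
  · obtain ⟨r, hr1, hr⟩ := hexists v b hb
    have : Tendsto (fun y => r * w y) l (𝓝 (r * v)) := hw.const_mul r
    filter_upwards [this.eventually (gt_mem_nhds hr), h r hr1] with y hy1 hy2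
    exact hy2.1.trans_lt hy1

section Riemannian

variable {d : ℕ} {M N : Type*}
  [TopologicalSpace M] [ChartedSpace (EuclideanSpace ℝ (Fin d)) M]
  [RiemannianBundle (fun x : M => TangentSpace (𝓡 d) x)]
  [TopologicalSpace N] [ChartedSpace (EuclideanSpace ℝ (Fin d)) N]
  [RiemannianBundle (fun x : N => TangentSpace (𝓡 d) x)]

/-- The Riemannian operator norm of the derivative of a `C¹` map is continuous. The derivatives act
between varying tangent spaces: they are compared in trivializations, which are almost isometric
near the base point. -/
lemma continuousAt_norm_mfderiv [IsManifold (𝓡 d) 1 M] [IsManifold (𝓡 d) 1 N]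
    [IsContinuousRiemannianBundle (EuclideanSpace ℝ (Fin d)) (fun x : M => TangentSpace (𝓡 d) x)]
    [IsContinuousRiemannianBundle (EuclideanSpace ℝ (Fin d)) (fun x : N => TangentSpace (𝓡 d) x)]
    {g : M → N} {x : M} (hg : ContMDiffAt (𝓡 d) (𝓡 d) 1 g x) :
    ContinuousAt (fun y => ‖mfderiv (𝓡 d) (𝓡 d) g y‖) x := by
  let E := EuclideanSpace ℝ (Fin d)
  let tM := trivializationAt E (fun x : M => TangentSpace (𝓡 d) x) x
  let tN := trivializationAt E (fun x : N => TangentSpace (𝓡 d) x) (g x)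
  -- `A y` is the derivative at `y` transported to the fibres over `x` and `g x`
  let A : M → (TangentSpace (𝓡 d) x →L[ℝ] TangentSpace (𝓡 d) (g x)) := fun y =>
    tN.symmL ℝ (g x) ∘L (inTangentCoordinates (𝓡 d) (𝓡 d) id g
      (fun y => mfderiv (𝓡 d) (𝓡 d) g y) x y) ∘L tM.continuousLinearMapAt ℝ x
  have hA : Tendsto (fun y => ‖A y‖) (𝓝 x) (𝓝 ‖A x‖) := by
    let B : M → (E →L[ℝ] E) := inTangentCoordinates (𝓡 d) (𝓡 d) id g
      (fun y => mfderiv (𝓡 d) (𝓡 d) g y) x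
    have hB : ContMDiffAt (𝓡 d) 𝓘(ℝ, E →L[ℝ] E) 0 B x := hg.mfderiv_const (by simp)
    have hB' : Tendsto (fun y => ‖tN.symmL ℝ (g x)‖ *
        (‖B y - B x‖ * ‖tM.continuousLinearMapAt ℝ x‖)) (𝓝 x) (𝓝 0) := by
      have h1 := tendsto_iff_norm_sub_tendsto_zero.1 hB.continuousAt.tendsto
      simpa using (h1.mul_const ‖tM.continuousLinearMapAt ℝ x‖).const_mul ‖tN.symmL ℝ (g x)‖
    rw [tendsto_iff_norm_sub_tendsto_zero]
    refine squeeze_zero (fun _ => norm_nonneg _) (fun y => ?_) hB'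
    refine (abs_norm_sub_norm_le (A y) (A x)).trans ?_
    have : A y - A x = tN.symmL ℝ (g x) ∘L (B y - B x) ∘L tM.continuousLinearMapAt ℝ x := by
      ext1 v
      simp [A, B]
    rw [this]
    exact (ContinuousLinearMap.opNorm_comp_le _ _).trans
      (mul_le_mul_of_nonneg_left (ContinuousLinearMap.opNorm_comp_le _ _) (norm_nonneg _))
  have hMx : x ∈ tM.baseSet := FiberBundle.mem_baseSet_trivializationAt' x
  have hNx : g x ∈ tN.baseSet := FiberBundle.mem_baseSet_trivializationAt' (g x)
  have hMbase : ∀ᶠ y in 𝓝 x, y ∈ tM.baseSet := tM.open_baseSet.mem_nhds hMx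
  have hNbase : ∀ᶠ y in 𝓝 x, g y ∈ tN.baseSet :=
    hg.continuousAt.eventually (tN.open_baseSet.mem_nhds hNx)
  -- `A y` and the derivative at `y` differ by transports whose norms are close to `1`
  have hAy : ∀ y, A y = (tN.symmL ℝ (g x) ∘L tN.continuousLinearMapAt ℝ (g y)) ∘L
      mfderiv (𝓡 d) (𝓡 d) g y ∘L (tM.symmL ℝ y ∘L tM.continuousLinearMapAt ℝ x) := fun y => rfl
  have hDy : ∀ y, y ∈ tM.baseSet → g y ∈ tN.baseSet → mfderiv (𝓡 d) (𝓡 d) g y =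
      (tN.symmL ℝ (g y) ∘L tN.continuousLinearMapAt ℝ (g x)) ∘L A y ∘L
        (tM.symmL ℝ x ∘L tM.continuousLinearMapAt ℝ y) := by
    intro y hy hgy
    ext1 v
    rw [hAy]
    simp only [ContinuousLinearMap.comp_apply]
    rw [tM.continuousLinearMapAt_symmL hMx, tM.symmL_continuousLinearMapAt hy,
      tN.continuousLinearMapAt_symmL hNx, tN.symmL_continuousLinearMapAt hgy]
  have hAx : A x = mfderiv (𝓡 d) (𝓡 d) g x := by
    ext1 v
    rw [hAy]
    simp only [ContinuousLinearMap.comp_apply]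
    rw [tM.symmL_continuousLinearMapAt hMx, tN.symmL_continuousLinearMapAt hNx]
  have hlim : Tendsto (fun y => ‖A y‖) (𝓝 x) (𝓝 ‖mfderiv (𝓡 d) (𝓡 d) g x‖) := by
    rw [← hAx]
    exact hA
  refine tendsto_of_eventually_le_mul hlim fun r hr => ?_
  have hs : 1 < √r := by rw [Real.lt_sqrt (by norm_num)]; simpa using hr
  have hss : √r * √r = r := Real.mul_self_sqrt (by linarith)
  have hprod : ∀ p q s : ℝ, 0 ≤ p → 0 ≤ q → 0 ≤ s → p < √r → s < √r → p * (q * s) ≤ r * q := by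
    intro p q s hp hq hs' hp1 hs1
    calc p * (q * s) = (p * s) * q := by ring
      _ ≤ (√r * √r) * q := by gcongr
      _ = r * q := by rw [hss]
  filter_upwards [hMbase, hNbase,
    eventually_norm_symmL_trivializationAt_self_comp_lt E
      (fun x : M => TangentSpace (𝓡 d) x) x hs,
    eventually_norm_symmL_trivializationAt_comp_self_lt E
      (fun x : M => TangentSpace (𝓡 d) x) x hs,
    hg.continuousAt.eventually (eventually_norm_symmL_trivializationAt_self_comp_lt E
      (fun x : N => TangentSpace (𝓡 d) x) (g x) hs),
    hg.continuousAt.eventually (eventually_norm_symmL_trivializationAt_comp_self_lt E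
      (fun x : N => TangentSpace (𝓡 d) x) (g x) hs)] with y hy hgy h1 h2 h3 h4
  constructor
  · calc ‖mfderiv (𝓡 d) (𝓡 d) g y‖ = _ := congrArg _ (hDy y hy hgy)
      _ ≤ _ := (ContinuousLinearMap.opNorm_comp_le _ _).trans
          (mul_le_mul_of_nonneg_left (ContinuousLinearMap.opNorm_comp_le _ _) (norm_nonneg _))
      _ ≤ _ := hprod _ _ _ (norm_nonneg _) (norm_nonneg _) (norm_nonneg _) h4 h1
  · calc ‖A y‖ = _ := congrArg _ (hAy y)
      _ ≤ _ := (ContinuousLinearMap.opNorm_comp_le _ _).trans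
          (mul_le_mul_of_nonneg_left (ContinuousLinearMap.opNorm_comp_le _ _) (norm_nonneg _))
      _ ≤ _ := hprod _ _ _ (norm_nonneg _) (norm_nonneg _) (norm_nonneg _) h3 h2

/-- A `C¹` map does not increase the length of paths in a region by more than a bound for the norm
of its derivative there. -/
lemma pathELength_comp_le {g : M → N} {T : Set M} (hT : IsOpen T)
    (hg : ContMDiffOn (𝓡 d) (𝓡 d) 1 g T) {K : ℝ≥0}
    (hK : ∀ y ∈ T, ‖mfderiv (𝓡 d) (𝓡 d) g y‖ₑ ≤ K) {γ : ℝ → M}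
    (hγ : ContMDiffOn 𝓘(ℝ) (𝓡 d) 1 γ (Icc 0 1)) (hγT : MapsTo γ (Icc 0 1) T) :
    pathELength (𝓡 d) (g ∘ γ) 0 1 ≤ K * pathELength (𝓡 d) γ 0 1 := by
  rw [pathELength_eq_lintegral_mfderivWithin_Icc, pathELength_eq_lintegral_mfderivWithin_Icc,
    ← lintegral_const_mul' _ _ ENNReal.coe_ne_top]
  refine setLIntegral_mono' measurableSet_Icc fun t ht => ?_
  have h1 : mfderivWithin 𝓘(ℝ) (𝓡 d) (g ∘ γ) (Icc 0 1) t =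
      (mfderiv (𝓡 d) (𝓡 d) g (γ t)) ∘L (mfderivWithin 𝓘(ℝ) (𝓡 d) γ (Icc 0 1) t) := by
    apply mfderiv_comp_mfderivWithin
    · exact (hg.contMDiffAt (hT.mem_nhds (hγT ht))).mdifferentiableAt one_ne_zero
    · exact hγ.mdifferentiableOn one_ne_zero t ht
    · rw [uniqueMDiffWithinAt_iff_uniqueDiffWithinAt]
      exact uniqueDiffOn_Icc zero_lt_one t ht
  have h2 : mfderivWithin 𝓘(ℝ) (𝓡 d) (g ∘ γ) (Icc 0 1) t 1 =
      (mfderiv (𝓡 d) (𝓡 d) g (γ t)) (mfderivWithin 𝓘(ℝ) (𝓡 d) γ (Icc 0 1) t 1) := congr($h1 1)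
  rw [h2]
  refine (ContinuousLinearMap.le_opENorm _ _).trans ?_
  gcongr
  exact hK _ (hγT ht)

end Riemannian

section Lipschitz

variable {d : ℕ} {M N : Type*}
  [PseudoEMetricSpace M] [ChartedSpace (EuclideanSpace ℝ (Fin d)) M]
  [RiemannianBundle (fun x : M => TangentSpace (𝓡 d) x)] [IsRiemannianManifold (𝓡 d) M]
  [PseudoEMetricSpace N] [ChartedSpace (EuclideanSpace ℝ (Fin d)) N]
  [RiemannianBundle (fun x : N => TangentSpace (𝓡 d) x)] [IsRiemannianManifold (𝓡 d) N]

/-- If the norm of the derivative of `g` is at most `K` on a ball, then `g` is `K`-Lipschitz on the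
concentric ball of radius three times smaller: almost minimizing paths between points of the small
ball stay in the large one. -/
lemma edist_le_of_enorm_mfderiv_le {g : M → N} {p : M} {r : ℝ≥0∞}
    (hg : ContMDiffOn (𝓡 d) (𝓡 d) 1 g (eball p r)) {K : ℝ≥0}
    (hK : ∀ y ∈ eball p r, ‖mfderiv (𝓡 d) (𝓡 d) g y‖ₑ ≤ K)
    {y z : M} (hy : y ∈ eball p (r / 3)) (hz : z ∈ eball p (r / 3)) :
    edist (g y) (g z) ≤ K * edist y z := by
  have hthird : r / 3 + (r / 3 + r / 3) = r := by
    rw [← add_assoc]; exact ENNReal.add_thirds r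
  have hyz : edist y z < r / 3 + r / 3 :=
    (edist_triangle_right y z p).trans_lt (ENNReal.add_lt_add hy hz)
  have hlt : ∀ ρ : ℝ≥0∞, edist y z < ρ → edist (g y) (g z) ≤ K * ρ := by
    intro ρ hρ
    have hρ' : riemannianEDist (𝓡 d) y z < min ρ (r / 3 + r / 3) := by
      rw [← IsRiemannianManifold.out (I := 𝓡 d) y z]
      exact lt_min hρ hyz
    obtain ⟨γ, hγ0, hγ1, hγ, hlen⟩ := exists_lt_of_riemannianEDist_lt hρ'
    have hγT : MapsTo γ (Icc 0 1) (eball p r) := by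
      intro t ht
      have h1 : edist y (γ t) < r / 3 + r / 3 := by
        rw [IsRiemannianManifold.out (I := 𝓡 d) y (γ t)]
        calc riemannianEDist (𝓡 d) y (γ t) ≤ pathELength (𝓡 d) γ 0 t :=
              riemannianEDist_le_pathELength (hγ.mono (Icc_subset_Icc_right ht.2)) hγ0 rfl ht.1
          _ ≤ pathELength (𝓡 d) γ 0 1 := pathELength_mono le_rfl ht.2
          _ < r / 3 + r / 3 := hlen.trans_le (min_le_right _ _)
      rw [mem_eball, ← hthird]
      calc edist (γ t) p ≤ edist (γ t) y + edist y p := edist_triangle _ _ _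
        _ = edist y p + edist y (γ t) := by rw [add_comm, edist_comm (γ t)]
        _ < _ := ENNReal.add_lt_add hy h1
    rw [IsRiemannianManifold.out (I := 𝓡 d) (g y) (g z)]
    calc riemannianEDist (𝓡 d) (g y) (g z) ≤ pathELength (𝓡 d) (g ∘ γ) 0 1 :=
          riemannianEDist_le_pathELength (hg.comp hγ hγT) (by simp [hγ0]) (by simp [hγ1])
            zero_le_one
      _ ≤ K * pathELength (𝓡 d) γ 0 1 := pathELength_comp_le isOpen_eball hg hK hγ hγT
      _ ≤ K * ρ := by gcongr; exact hlen.le.trans (min_le_left _ _)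
  have hne : edist y z ≠ ⊤ := (hyz.trans_le le_top).ne
  have htend : Tendsto (fun ρ => (K : ℝ≥0∞) * ρ) (𝓝[>] (edist y z)) (𝓝 (K * edist y z)) :=
    (ENNReal.continuous_const_mul ENNReal.coe_ne_top).continuousWithinAt
  have : (𝓝[>] (edist y z)).NeBot := nhdsGT_neBot_of_exists_gt ⟨⊤, hne.lt_top⟩
  exact ge_of_tendsto htend (by filter_upwards [self_mem_nhdsWithin] with ρ hρ using hlt ρ hρ)

end Lipschitz

/-! ### The Riemannian volume in charts -/

section LinDensity

variable {d : ℕ} {V : Type*} [NormedAddCommGroup V] [InnerProductSpace ℝ V]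

/-- The factor by which a linear map from `ℝ^d` to an inner product space multiplies
`d`-dimensional volumes. -/
noncomputable def linDensity (A : EuclideanSpace ℝ (Fin d) →L[ℝ] V) : ℝ :=
  √(Matrix.gram ℝ fun i : Fin d => A (EuclideanSpace.single i (1 : ℝ))).det

/-- The Gram matrix of `A ∘ D` is `Pᵀ G P`, where `G` is that of `A` and `P` is the matrix of
`D`. -/
lemma linDensity_comp (A : EuclideanSpace ℝ (Fin d) →L[ℝ] V)
    (D : EuclideanSpace ℝ (Fin d) →L[ℝ] EuclideanSpace ℝ (Fin d)) :
    linDensity (A ∘L D) = |D.det| * linDensity A := by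
  set P : Matrix (Fin d) (Fin d) ℝ :=
    Matrix.of fun k i => (D (EuclideanSpace.single i (1 : ℝ))) k with hP
  have hdet : D.det = P.det := by
    rw [ContinuousLinearMap.det,
      ← LinearMap.det_toMatrix (EuclideanSpace.basisFun (Fin d) ℝ).toBasis]
    congr 1
  have hexp : ∀ i, A (D (EuclideanSpace.single i (1 : ℝ))) =
      ∑ k, P k i • A (EuclideanSpace.single k (1 : ℝ)) := by
    intro i
    conv_lhs => rw [← (EuclideanSpace.basisFun (Fin d) ℝ).sum_repr (D (EuclideanSpace.single i 1))]
    simp [hP]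
  have hgram : Matrix.gram ℝ (fun i : Fin d => A (D (EuclideanSpace.single i (1 : ℝ)))) =
      P.transpose * Matrix.gram ℝ (fun i : Fin d => A (EuclideanSpace.single i (1 : ℝ))) * P := by
    ext i j
    simp only [Matrix.gram_apply, hexp, Matrix.mul_apply, Matrix.transpose_apply, sum_inner,
      inner_sum, inner_smul_left, inner_smul_right, Finset.sum_mul, Finset.mul_sum,
      conj_trivial]
    exact Finset.sum_congr rfl fun k _ => Finset.sum_congr rfl fun l _ => by ring
  simp only [linDensity, ContinuousLinearMap.comp_apply]
  rw [hgram, Matrix.det_mul, Matrix.det_mul, Matrix.det_transpose, hdet,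
    show P.det * (Matrix.gram ℝ fun i : Fin d => A (EuclideanSpace.single i (1 : ℝ))).det * P.det =
      P.det ^ 2 * (Matrix.gram ℝ fun i : Fin d => A (EuclideanSpace.single i (1 : ℝ))).det by ring,
    Real.sqrt_mul (sq_nonneg _), Real.sqrt_sq_eq_abs]

lemma det_gram_pos {A : EuclideanSpace ℝ (Fin d) →L[ℝ] V} (h : Function.Injective A) :
    0 < (Matrix.gram ℝ fun i : Fin d => A (EuclideanSpace.single i (1 : ℝ))).det := by
  refine (Matrix.posDef_gram_of_linearIndependent ?_).det_pos
  have h1 := (EuclideanSpace.basisFun (Fin d) ℝ).toBasis.linearIndependent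
  have h2 := h1.map' A.toLinearMap (LinearMap.ker_eq_bot.2 h)
  convert! h2 using 1
  funext i
  simp

end LinDensity

section Density

variable {d : ℕ} {M : Type*} [TopologicalSpace M] [ChartedSpace (EuclideanSpace ℝ (Fin d)) M]
  [RiemannianBundle (fun x : M => TangentSpace (𝓡 d) x)]

/-- The factor by which a map `F` from a Euclidean space to a Riemannian manifold of the same
dimension multiplies volumes at the point `v`. -/
noncomputable def mapDensity (F : EuclideanSpace ℝ (Fin d) → M) (v : EuclideanSpace ℝ (Fin d)) :
    ℝ :=
  linDensity (V := TangentSpace (𝓡 d) (F v)) (mfderiv (𝓡 d) (𝓡 d) F v)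

lemma volumeDensity_eq (x : M) :
    volumeDensity x = mapDensity (chartAt (EuclideanSpace ℝ (Fin d)) x).symm := rfl

lemma mapDensity_congr {F F' : EuclideanSpace ℝ (Fin d) → M} {v : EuclideanSpace ℝ (Fin d)}
    (h : F =ᶠ[𝓝 v] F') : mapDensity F v = mapDensity F' v := by
  -- the two derivatives take values in the tangent spaces at `F v` and `F' v`
  have key : ∀ p q : M, p = q →
      ∀ A : EuclideanSpace ℝ (Fin d) →L[ℝ] EuclideanSpace ℝ (Fin d),
      linDensity (V := TangentSpace (𝓡 d) p) A = linDensity (V := TangentSpace (𝓡 d) q) A := by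
    rintro p _ rfl A; rfl
  refine (key _ _ h.eq_of_nhds (mfderiv (𝓡 d) (𝓡 d) F v)).trans ?_
  exact congrArg (linDensity (V := TangentSpace (𝓡 d) (F' v))) h.mfderiv_eq

/-- The chain rule for densities. -/
lemma mapDensity_comp {F : EuclideanSpace ℝ (Fin d) → M}
    {ψ : EuclideanSpace ℝ (Fin d) → EuclideanSpace ℝ (Fin d)} {v : EuclideanSpace ℝ (Fin d)}
    (hF : MDifferentiableAt (𝓡 d) (𝓡 d) F (ψ v)) (hψ : DifferentiableAt ℝ ψ v) :
    mapDensity (F ∘ ψ) v = |(fderiv ℝ ψ v).det| * mapDensity F (ψ v) := by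
  have h : mfderiv (𝓡 d) (𝓡 d) (F ∘ ψ) v =
      (mfderiv (𝓡 d) (𝓡 d) F (ψ v)).comp (fderiv ℝ ψ v) := by
    rw [mfderiv_comp v hF hψ.mdifferentiableAt, mfderiv_eq_fderiv]
    rfl
  exact (congrArg (linDensity (V := TangentSpace (𝓡 d) (F (ψ v)))) h).trans
    (linDensity_comp (V := TangentSpace (𝓡 d) (F (ψ v))) _ _)

lemma mapDensity_pos {F : EuclideanSpace ℝ (Fin d) → M} {v : EuclideanSpace ℝ (Fin d)}
    (h : Function.Injective (mfderiv (𝓡 d) (𝓡 d) F v)) : 0 < mapDensity F v :=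
  Real.sqrt_pos.2 (det_gram_pos (V := TangentSpace (𝓡 d) (F v)) h)

/-- The density of a `C²` immersion is `C¹`, being the square root of a nonzero polynomial in the
inner products of the images of the coordinate vector fields. -/
lemma contDiffAt_mapDensity [IsManifold (𝓡 d) ∞ M]
    [IsContMDiffRiemannianBundle (𝓡 d) ∞ (EuclideanSpace ℝ (Fin d))
      (fun x : M => TangentSpace (𝓡 d) x)]
    {F : EuclideanSpace ℝ (Fin d) → M} {v : EuclideanSpace ℝ (Fin d)}
    (hF : ContMDiffAt (𝓡 d) (𝓡 d) 2 F v) (h : Function.Injective (mfderiv (𝓡 d) (𝓡 d) F v)) :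
    ContDiffAt ℝ 1 (mapDensity F) v := by
  have hsec : ∀ i : Fin d, ContMDiffAt (𝓡 d) ((𝓡 d).prod 𝓘(ℝ, EuclideanSpace ℝ (Fin d))) 1
      (fun w : EuclideanSpace ℝ (Fin d) => (⟨F w, mfderiv (𝓡 d) (𝓡 d) F w
        (EuclideanSpace.single i (1 : ℝ) : EuclideanSpace ℝ (Fin d))⟩ :
        TotalSpace (EuclideanSpace ℝ (Fin d)) (fun x : M => TangentSpace (𝓡 d) x))) v := by
    intro i
    have h0 : ContMDiffAt (𝓡 d) 𝓘(ℝ, EuclideanSpace ℝ (Fin d) →L[ℝ] EuclideanSpace ℝ (Fin d)) 1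
      (inTangentCoordinates (𝓡 d) (𝓡 d) id F (fun y => mfderiv (𝓡 d) (𝓡 d) F y) v) v :=
      hF.mfderiv_const (by norm_num)
    have hv : ContMDiffAt (𝓡 d) (𝓡 d).tangent 1
        (fun w : EuclideanSpace ℝ (Fin d) =>
          (⟨w, (EuclideanSpace.single i (1 : ℝ) : EuclideanSpace ℝ (Fin d))⟩ :
          TangentBundle (𝓡 d) (EuclideanSpace ℝ (Fin d)))) v :=
      contMDiffAt_vectorSpace_iff_contDiffAt.2 contDiffAt_const
    exact ContMDiffAt.clm_apply_of_inCoordinates h0 hv (hF.of_le (by norm_num))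
  have : IsContMDiffRiemannianBundle (𝓡 d) 1 (EuclideanSpace ℝ (Fin d))
      (fun x : M => TangentSpace (𝓡 d) x) := IsContMDiffRiemannianBundle.of_le (n := ∞) (by simp)
  have hinner : ∀ i j : Fin d, ContDiffAt ℝ 1 (fun w =>
      inner ℝ (mfderiv (𝓡 d) (𝓡 d) F w
        (EuclideanSpace.single i (1 : ℝ) : EuclideanSpace ℝ (Fin d)))
      (mfderiv (𝓡 d) (𝓡 d) F w
        (EuclideanSpace.single j (1 : ℝ) : EuclideanSpace ℝ (Fin d)))) v := by
    intro i j
    have h1 := ContMDiffAt.inner_bundle (n := 1) (IB := 𝓡 d) (b := F) (hsec i) (hsec j)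
    exact h1.contDiffAt
  refine ContDiffAt.sqrt ?_ (det_gram_pos (V := TangentSpace (𝓡 d) (F v)) h).ne'
  simp only [Matrix.det_apply, Matrix.gram_apply]
  refine ContDiffAt.sum fun s _ => ?_
  exact (contDiffAt_prod fun k _ => hinner _ _).const_smul _

end Density

section ChartVolume

variable {d : ℕ} {M : Type*} [TopologicalSpace M] [ChartedSpace (EuclideanSpace ℝ (Fin d)) M]

lemma chart_image_eq (x : M) {E : Set M} (hE : E ⊆ (chartAt (EuclideanSpace ℝ (Fin d)) x).source) :
    chartAt (EuclideanSpace ℝ (Fin d)) x '' E = (chartAt (EuclideanSpace ℝ (Fin d)) x).target ∩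
      (chartAt (EuclideanSpace ℝ (Fin d)) x).symm ⁻¹' E := by
  have := (chartAt (EuclideanSpace ℝ (Fin d)) x).image_source_inter_eq' E
  rwa [inter_eq_self_of_subset_right hE] at this

lemma mdifferentiableAt_chart_symm [IsManifold (𝓡 d) ∞ M] (x : M) {v : EuclideanSpace ℝ (Fin d)}
    (hv : v ∈ (chartAt (EuclideanSpace ℝ (Fin d)) x).target) :
    MDifferentiableAt (𝓡 d) (𝓡 d) (chartAt (EuclideanSpace ℝ (Fin d)) x).symm v :=
  ((contMDiffOn_chart_symm (I := 𝓡 d) (n := ∞) (x := x)).contMDiffAt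
    ((chartAt _ x).open_target.mem_nhds hv)).mdifferentiableAt (by simp)

lemma injective_mfderiv_chart_symm [IsManifold (𝓡 d) ∞ M] (x : M) {v : EuclideanSpace ℝ (Fin d)}
    (hv : v ∈ (chartAt (EuclideanSpace ℝ (Fin d)) x).target) :
    Function.Injective (mfderiv (𝓡 d) (𝓡 d) (chartAt (EuclideanSpace ℝ (Fin d)) x).symm v) := by
  have : IsManifold (𝓡 d) 1 M := IsManifold.of_le (n := ∞) (by simp)
  have := (mdifferentiable_chart (I := 𝓡 d) x).symm
  exact this.mfderiv_injective hv

section Measurable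

variable [MeasurableSpace M] [BorelSpace M]

lemma measurableSet_chart_target_inter (x : M) {E : Set M} (hE : MeasurableSet E) :
    MeasurableSet ((chartAt (EuclideanSpace ℝ (Fin d)) x).target ∩
      (chartAt (EuclideanSpace ℝ (Fin d)) x).symm ⁻¹' E) := by
  set φ := chartAt (EuclideanSpace ℝ (Fin d)) x
  have h1 : Measurable (φ.target.domRestrict φ.symm) :=
    (continuousOn_iff_continuous_domRestrict.1 φ.continuousOn_symm).measurable
  have h2 := φ.open_target.measurableSet.subtype_image (h1 hE)
  rwa [show Subtype.val '' (φ.target.domRestrict φ.symm ⁻¹' E) = φ.target ∩ φ.symm ⁻¹' E by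
    ext v; simp [domRestrict, and_comm]] at h2

lemma measurableSet_chart_image (x : M) {E : Set M}
    (hE : E ⊆ (chartAt (EuclideanSpace ℝ (Fin d)) x).source) (hm : MeasurableSet E) :
    MeasurableSet (chartAt (EuclideanSpace ℝ (Fin d)) x '' E) := by
  rw [chart_image_eq x hE]
  exact measurableSet_chart_target_inter x hm

end Measurable

variable [RiemannianBundle (fun x : M => TangentSpace (𝓡 d) x)]

lemma volumeDensity_pos [IsManifold (𝓡 d) ∞ M] (x : M) {v : EuclideanSpace ℝ (Fin d)}
    (hv : v ∈ (chartAt (EuclideanSpace ℝ (Fin d)) x).target) : 0 < volumeDensity x v :=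
  mapDensity_pos (injective_mfderiv_chart_symm x hv)

lemma contDiffAt_volumeDensity [IsManifold (𝓡 d) ∞ M]
    [IsContMDiffRiemannianBundle (𝓡 d) ∞ (EuclideanSpace ℝ (Fin d))
      (fun x : M => TangentSpace (𝓡 d) x)] (x : M) {v : EuclideanSpace ℝ (Fin d)}
    (hv : v ∈ (chartAt (EuclideanSpace ℝ (Fin d)) x).target) :
    ContDiffAt ℝ 1 (volumeDensity x) v :=
  contDiffAt_mapDensity (((contMDiffOn_chart_symm (I := 𝓡 d) (n := 2) (x := x)).contMDiffAt
    ((chartAt _ x).open_target.mem_nhds hv))) (injective_mfderiv_chart_symm x hv)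

variable [MeasurableSpace M] [BorelSpace M]

lemma chartVolume_apply (x : M) {E : Set M} (hE : MeasurableSet E) :
    chartVolume (d := d) x E = ∫⁻ v in (chartAt (EuclideanSpace ℝ (Fin d)) x).target ∩
      (chartAt (EuclideanSpace ℝ (Fin d)) x).symm ⁻¹' E,
        ENNReal.ofReal (volumeDensity x v) := by
  set φ := chartAt (EuclideanSpace ℝ (Fin d)) x with hφ
  have ht : MeasurableSet φ.target := φ.open_target.measurableSet
  have hm := measurableSet_chart_target_inter (d := d) x hE
  have hae : AEMeasurable φ.symm (volume.restrict φ.target) :=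
    φ.continuousOn_symm.aemeasurable ht
  rw [chartVolume, Measure.map_apply_of_aemeasurable
    (hae.mono_ac (withDensity_absolutelyContinuous _ _)) hE, ← restrict_withDensity ht,
    Measure.restrict_apply' ht, inter_comm, withDensity_apply _ hm]

lemma chartVolume_apply_of_subset (x : M) {E : Set M}
    (hE : E ⊆ (chartAt (EuclideanSpace ℝ (Fin d)) x).source) (hm : MeasurableSet E) :
    chartVolume (d := d) x E = ∫⁻ v in chartAt (EuclideanSpace ℝ (Fin d)) x '' E,
        ENNReal.ofReal (volumeDensity x v) := by
  rw [chartVolume_apply x hm, chart_image_eq x hE]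

lemma chartVolume_inter_source (x : M) {E : Set M} (hE : MeasurableSet E) :
    chartVolume (d := d) x (E ∩ (chartAt (EuclideanSpace ℝ (Fin d)) x).source) =
      chartVolume (d := d) x E := by
  rw [chartVolume_apply x hE,
    chartVolume_apply x (hE.inter (chartAt (EuclideanSpace ℝ (Fin d)) x).open_source.measurableSet)]
  congr 2
  ext v
  simp only [mem_inter_iff, mem_preimage]
  exact ⟨fun h => ⟨h.1, h.2.1⟩, fun h => ⟨h.1, h.2, (chartAt _ x).map_target h.1⟩⟩

variable [IsManifold (𝓡 d) ∞ M]

/-- Change of variables: the volume of the image of `E` under an injective map `h` that is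
differentiable in charts, computed in the chart containing `E`. -/
lemma chartVolume_image (x y : M) {h : M → M} {E : Set M} (hm : MeasurableSet E)
    (hE : E ⊆ (chartAt (EuclideanSpace ℝ (Fin d)) y).source)
    (hh : MapsTo h E (chartAt (EuclideanSpace ℝ (Fin d)) x).source) (hinj : InjOn h E)
    (hhm : MeasurableSet (h '' E)) (hcont : ∀ p ∈ E, ContinuousAt h p)
    (hdiff : ∀ p ∈ E, MDifferentiableAt (𝓡 d) (𝓡 d) h p) :
    chartVolume (d := d) x (h '' E) = ∫⁻ v in chartAt (EuclideanSpace ℝ (Fin d)) y '' E,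
      ENNReal.ofReal (mapDensity (h ∘ (chartAt (EuclideanSpace ℝ (Fin d)) y).symm) v) := by
  set φ := chartAt (EuclideanSpace ℝ (Fin d)) x with hφ
  set χ := chartAt (EuclideanSpace ℝ (Fin d)) y with hχ
  -- `ψ` is the map `h` read in the charts
  let ψ : EuclideanSpace ℝ (Fin d) → EuclideanSpace ℝ (Fin d) := φ ∘ h ∘ χ.symm
  have himg : φ '' (h '' E) = ψ '' (χ '' E) := by
    rw [image_image, image_image]
    refine image_congr fun p hp => ?_
    simp [ψ, χ.left_inv (hE hp)]
  have hd : ∀ v ∈ χ '' E, DifferentiableAt ℝ ψ v := by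
    rintro _ ⟨p, hp, rfl⟩
    rw [← mdifferentiableAt_iff_differentiableAt]
    have e := χ.left_inv (hE hp)
    have h1 : MDifferentiableAt (𝓡 d) (𝓡 d) φ (h (χ.symm (χ p))) := by
      rw [e]
      exact ((contMDiffOn_chart (I := 𝓡 d) (n := ∞) (x := x)).contMDiffAt
        (φ.open_source.mem_nhds (hh hp))).mdifferentiableAt (by simp)
    have h2 : MDifferentiableAt (𝓡 d) (𝓡 d) h (χ.symm (χ p)) := by
      rw [e]; exact hdiff p hp
    have h3 := mdifferentiableAt_chart_symm (d := d) y (χ.map_source (hE hp))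
    exact h1.comp (χ p) (h2.comp (χ p) h3)
  have hψinj : InjOn ψ (χ '' E) := by
    rintro _ ⟨p, hp, rfl⟩ _ ⟨q, hq, rfl⟩ hpq
    simp only [ψ, Function.comp_apply, χ.left_inv (hE hp), χ.left_inv (hE hq)] at hpq
    rw [hinj hp hq (φ.injOn (hh hp) (hh hq) hpq)]
  rw [chartVolume_apply_of_subset x hh.image_subset hhm, ← hφ, himg,
    lintegral_image_eq_lintegral_abs_det_fderiv_mul volume (measurableSet_chart_image y hE hm)
      (fun v hv => (hd v hv).hasFDerivAt.hasFDerivWithinAt) hψinj]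
  refine setLIntegral_congr_fun (measurableSet_chart_image y hE hm) fun v hv => ?_
  have hv' := hv
  obtain ⟨p, hp, rfl⟩ := hv
  have e := χ.left_inv (hE hp)
  rw [← ENNReal.ofReal_mul (abs_nonneg _), volumeDensity_eq, ← hφ,
    ← mapDensity_comp (mdifferentiableAt_chart_symm x ?_) (hd _ hv')]
  · congr 1
    apply mapDensity_congr
    have h1 : Tendsto (h ∘ χ.symm) (𝓝 (χ p)) (𝓝 (h p)) := by
      have h2 := χ.continuousAt_symm (χ.map_source (hE hp))
      have h3 : ContinuousAt h (χ.symm (χ p)) := by rw [e]; exact hcont p hp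
      have := h3.comp h2
      rw [ContinuousAt, Function.comp_apply, e] at this
      exact this
    filter_upwards [h1.eventually (φ.open_source.mem_nhds (hh hp))] with w hw
    exact φ.left_inv hw
  · change φ (h (χ.symm (χ p))) ∈ φ.target
    rw [e]
    exact φ.map_source (hh hp)

/-- Chart volumes agree on overlaps. -/
lemma chartVolume_eq_chartVolume (x y : M) {E : Set M} (hm : MeasurableSet E)
    (hx : E ⊆ (chartAt (EuclideanSpace ℝ (Fin d)) x).source)
    (hy : E ⊆ (chartAt (EuclideanSpace ℝ (Fin d)) y).source) :
    chartVolume (d := d) x E = chartVolume (d := d) y E := by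
  have := chartVolume_image (d := d) x y (h := id) hm hy hx (injOn_id E) (by simpa using hm)
    (fun _ _ => continuousAt_id) (fun _ _ => mdifferentiableAt_id)
  rw [image_id] at this
  rw [this, chartVolume_apply_of_subset y hy hm]
  rfl

/-- The Riemannian volume restricts to the chart volume on each chart domain. -/
lemma riemannianVolume_eq_chartVolume (y : M) {E : Set M} (hm : MeasurableSet E)
    (hE : E ⊆ (chartAt (EuclideanSpace ℝ (Fin d)) y).source) :
    riemannianVolume d M E = chartVolume (d := d) y E := by
  set U := (chartAt (EuclideanSpace ℝ (Fin d)) y).source with hU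
  have hUm : MeasurableSet U := (chartAt (EuclideanSpace ℝ (Fin d)) y).open_source.measurableSet
  have hle : ∀ x, chartVolume (d := d) x ≤ riemannianVolume d M := fun x => le_iSup _ x
  refine le_antisymm ?_ (hle y E)
  -- this measure dominates all chart volumes, hence their supremum
  have hdom : riemannianVolume d M ≤
      (chartVolume (d := d) y).restrict U + (riemannianVolume d M).restrict Uᶜ := by
    refine iSup_le fun x => Measure.le_iff.2 fun A hA => ?_
    set W := (chartAt (EuclideanSpace ℝ (Fin d)) x).source
    have hWm : MeasurableSet W :=
      (chartAt (EuclideanSpace ℝ (Fin d)) x).open_source.measurableSet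
    rw [Measure.add_apply, Measure.restrict_apply hA, Measure.restrict_apply hA,
      ← measure_inter_add_sdiff A hUm, sdiff_eq]
    refine add_le_add ?_ (hle x _)
    · rw [← chartVolume_inter_source x (hA.inter hUm),
        chartVolume_eq_chartVolume x y ((hA.inter hUm).inter hWm) inter_subset_right
          (inter_subset_left.trans inter_subset_right)]
      exact measure_mono inter_subset_left
  calc riemannianVolume d M E ≤ _ := hdom E
    _ = chartVolume (d := d) y E := by
      rw [Measure.add_apply, Measure.restrict_apply hm, Measure.restrict_apply hm,
        inter_eq_self_of_subset_left hE, (disjoint_compl_right_iff_subset.2 hE).inter_eq]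
      simp

variable [IsContMDiffRiemannianBundle (𝓡 d) ∞ (EuclideanSpace ℝ (Fin d))
      (fun x : M => TangentSpace (𝓡 d) x)]

lemma riemannianVolume_ne_zero_of_isOpen {O : Set M} (hO : IsOpen O) (hne : O.Nonempty) :
    riemannianVolume d M O ≠ 0 := by
  obtain ⟨x, hx⟩ := hne
  set φ := chartAt (EuclideanSpace ℝ (Fin d)) x with hφ
  have hxs : x ∈ φ.source := mem_chart_source _ x
  have hm : MeasurableSet (O ∩ φ.source) := (hO.inter φ.open_source).measurableSet
  have hpos := volumeDensity_pos x (φ.map_source hxs)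
  have hc := (contDiffAt_volumeDensity x (φ.map_source hxs)).continuousAt
  set c := volumeDensity x (φ x)
  have hopen : IsOpen (φ '' (O ∩ φ.source)) :=
    φ.isOpen_image_of_subset_source (hO.inter φ.open_source) inter_subset_right
  obtain ⟨W, hWsub, hWo, hxW⟩ := _root_.mem_nhds_iff.1 (inter_mem
    (hopen.mem_nhds (mem_image_of_mem φ ⟨hx, hxs⟩))
    (hc.eventually (lt_mem_nhds (half_lt_self hpos))))
  have h1 : ENNReal.ofReal (c / 2) * volume W ≤ riemannianVolume d M O := by
    calc ENNReal.ofReal (c / 2) * volume W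
        = ∫⁻ _ in W, ENNReal.ofReal (c / 2) := by rw [setLIntegral_const]
      _ ≤ ∫⁻ v in W, ENNReal.ofReal (volumeDensity x v) :=
          setLIntegral_mono' hWo.measurableSet fun v hv =>
            ENNReal.ofReal_le_ofReal (hWsub hv).2.le
      _ ≤ ∫⁻ v in φ '' (O ∩ φ.source), ENNReal.ofReal (volumeDensity x v) :=
          lintegral_mono_set fun v hv => (hWsub hv).1
      _ = riemannianVolume d M (O ∩ φ.source) := by
          rw [riemannianVolume_eq_chartVolume x hm inter_subset_right,
            chartVolume_apply_of_subset x inter_subset_right hm]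
      _ ≤ _ := measure_mono inter_subset_left
  intro h0
  rw [h0] at h1
  have h2 : volume W ≠ 0 := (hWo.measure_pos volume ⟨_, hxW⟩).ne'
  exact mul_ne_zero (ENNReal.ofReal_pos.2 (half_pos hpos)).ne' h2 (le_zero_iff.1 h1)

lemma riemannianVolume_univ_lt_top [CompactSpace M] : riemannianVolume d M univ < ⊤ := by
  refine isCompact_univ.measure_lt_top_of_nhdsWithin fun x _ => ?_
  rw [nhdsWithin_univ]
  set φ := chartAt (EuclideanSpace ℝ (Fin d)) x with hφ
  have hxs : x ∈ φ.source := mem_chart_source _ x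
  have hc := (contDiffAt_volumeDensity x (φ.map_source hxs)).continuousAt
  -- near the image of `x` in the chart the density is bounded
  obtain ⟨r, hr, hsub⟩ := Metric.mem_nhds_iff.1
    (hc.eventually (gt_mem_nhds (lt_add_one (volumeDensity x (φ x)))))
  have hO : IsOpen (φ.source ∩ φ ⁻¹' ball (φ x) r) := φ.isOpen_inter_preimage isOpen_ball
  refine ⟨_, hO.mem_nhds ⟨hxs, mem_ball_self hr⟩, ?_⟩
  rw [riemannianVolume_eq_chartVolume x hO.measurableSet inter_subset_left,
    chartVolume_apply_of_subset x inter_subset_left hO.measurableSet]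
  have himage : φ '' (φ.source ∩ φ ⁻¹' ball (φ x) r) ⊆ ball (φ x) r := by
    rintro _ ⟨y, hy, rfl⟩
    exact hy.2
  calc _ ≤ ∫⁻ v in ball (φ x) r, ENNReal.ofReal (volumeDensity x v) := lintegral_mono_set himage
    _ ≤ ∫⁻ _ in ball (φ x) r, ENNReal.ofReal (volumeDensity x (φ x) + 1) :=
        setLIntegral_mono' measurableSet_ball fun v hv =>
          ENNReal.ofReal_le_ofReal (le_of_lt (hsub hv))
    _ < ⊤ := by
        rw [setLIntegral_const]
        exact ENNReal.mul_lt_top ENNReal.ofReal_lt_top measure_ball_lt_top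

end ChartVolume

/-! ### Bounded distortion of `C²` maps -/

/-- The canonical Riemannian structure of an inner product space is continuous. -/
lemma isContinuousRiemannianBundle_self (d : ℕ) :
    IsContinuousRiemannianBundle (EuclideanSpace ℝ (Fin d))
      (fun x : EuclideanSpace ℝ (Fin d) => TangentSpace (𝓡 d) x) :=
  ⟨(riemannianMetricVectorSpace (EuclideanSpace ℝ (Fin d))).inner,
    (riemannianMetricVectorSpace (EuclideanSpace ℝ (Fin d))).contMDiff.continuous,
    fun _ _ _ => rfl⟩

lemma isContinuousRiemannianBundle_of_contMDiff {d : ℕ} {M : Type*} [TopologicalSpace M]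
    [ChartedSpace (EuclideanSpace ℝ (Fin d)) M] [IsManifold (𝓡 d) ∞ M]
    [RiemannianBundle (fun x : M => TangentSpace (𝓡 d) x)]
    [IsContMDiffRiemannianBundle (𝓡 d) ∞ (EuclideanSpace ℝ (Fin d))
      (fun x : M => TangentSpace (𝓡 d) x)] :
    IsContinuousRiemannianBundle (EuclideanSpace ℝ (Fin d))
      (fun x : M => TangentSpace (𝓡 d) x) := by
  have hM1 : IsManifold (𝓡 d) 1 M := IsManifold.of_le (n := ∞) (by simp)
  have : IsContMDiffRiemannianBundle (𝓡 d) 1 (EuclideanSpace ℝ (Fin d))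
      (fun x : M => TangentSpace (𝓡 d) x) := IsContMDiffRiemannianBundle.of_le (n := ∞) (by simp)
  obtain ⟨g, hg, h⟩ := this.exists_contMDiff
  exact ⟨g, hg.continuous, h⟩

section Distortion

variable {d : ℕ} {M : Type*} [PseudoEMetricSpace M] [ChartedSpace (EuclideanSpace ℝ (Fin d)) M]
  [IsManifold (𝓡 d) ∞ M] [RiemannianBundle (fun x : M => TangentSpace (𝓡 d) x)]
  [IsContMDiffRiemannianBundle (𝓡 d) ∞ (EuclideanSpace ℝ (Fin d))
      (fun x : M => TangentSpace (𝓡 d) x)] [IsRiemannianManifold (𝓡 d) M]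

/-- Charts are locally Lipschitz for the Riemannian distance. -/
lemma exists_edist_chart_le (x : M) : ∃ K : ℝ≥0, ∃ r : ℝ≥0∞, 0 < r ∧
    ∀ y ∈ eball x r, ∀ z ∈ eball x r, edist (chartAt (EuclideanSpace ℝ (Fin d)) x y)
      (chartAt (EuclideanSpace ℝ (Fin d)) x z) ≤ K * edist y z := by
  set φ := chartAt (EuclideanSpace ℝ (Fin d)) x
  have hM1 : IsManifold (𝓡 d) 1 M := IsManifold.of_le (n := ∞) (by simp)
  have hMc := isContinuousRiemannianBundle_of_contMDiff (d := d) (M := M)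
  have hEc := isContinuousRiemannianBundle_self d
  have hφ : ContMDiffOn (𝓡 d) (𝓡 d) 1 φ φ.source := contMDiffOn_chart
  have hcont := continuousAt_norm_mfderiv
    (hφ.contMDiffAt (φ.open_source.mem_nhds (mem_chart_source _ x)))
  obtain ⟨K, hK⟩ : ∃ K : ℝ≥0, ‖mfderiv (𝓡 d) (𝓡 d) φ x‖ < K :=
    ⟨(‖mfderiv (𝓡 d) (𝓡 d) φ x‖ + 1).toNNReal,
      (lt_add_one _).trans_le (Real.le_coe_toNNReal _)⟩
  obtain ⟨r, hr, hsub⟩ := EMetric.mem_nhds_iff.1 (inter_mem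
    (φ.open_source.mem_nhds (mem_chart_source _ x)) (hcont.eventually (gt_mem_nhds hK)))
  refine ⟨K, r / 3, ENNReal.div_pos hr.ne' (by norm_num), fun y hy z hz => ?_⟩
  refine edist_le_of_enorm_mfderiv_le (hφ.mono fun w hw => (hsub hw).1) (fun w hw => ?_) hy hz
  rw [← ofReal_norm, ← ENNReal.ofReal_coe_nnreal]
  exact ENNReal.ofReal_le_ofReal (hsub hw).2.le

variable [MeasurableSpace M] [BorelSpace M]

/-- Bounded distortion of a `C²` immersion `g` between open subsets: near each point, the
logarithm of its Jacobian is Lipschitz. -/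
lemma exists_distortion_bound {g : M → M} {U : Set M} (hU : IsOpen U)
    (hg : ContMDiffOn (𝓡 d) (𝓡 d) 2 g U) (hinj : InjOn g U)
    (hder : ∀ y ∈ U, Function.Injective (mfderiv (𝓡 d) (𝓡 d) g y))
    (himg : ∀ E ⊆ U, MeasurableSet E → MeasurableSet (g '' E)) {y₀ : M} (hy₀ : y₀ ∈ U) :
    ∃ T ∈ 𝓝 y₀, ∃ L : ℝ, 0 ≤ L ∧ ∀ S ⊆ T, ∀ r : ℝ, 0 ≤ r → ediam S ≤ ENNReal.ofReal r →
      ∃ c : ℝ≥0∞, c ≠ 0 ∧ ∀ E ⊆ S, MeasurableSet E →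
        c * riemannianVolume d M E ≤ riemannianVolume d M (g '' E) ∧
        riemannianVolume d M (g '' E) ≤
          ENNReal.ofReal (Real.exp (L * r)) * (c * riemannianVolume d M E) := by
  set χ := chartAt (EuclideanSpace ℝ (Fin d)) y₀ with hχ
  set φ := chartAt (EuclideanSpace ℝ (Fin d)) (g y₀) with hφ
  have hy₀s : y₀ ∈ χ.source := mem_chart_source _ y₀
  let F : EuclideanSpace ℝ (Fin d) → M := g ∘ χ.symm
  have he : χ.symm (χ y₀) = y₀ := χ.left_inv hy₀s
  have hsymm : ContMDiffAt (𝓡 d) (𝓡 d) 2 χ.symm (χ y₀) :=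
    (contMDiffOn_chart_symm (I := 𝓡 d) (n := 2) (x := y₀)).contMDiffAt
      (χ.open_target.mem_nhds (χ.map_source hy₀s))
  have hgat : ContMDiffAt (𝓡 d) (𝓡 d) 2 g (χ.symm (χ y₀)) := by
    rw [he]; exact hg.contMDiffAt (hU.mem_nhds hy₀)
  have hF : ContMDiffAt (𝓡 d) (𝓡 d) 2 F (χ y₀) := hgat.comp (χ y₀) hsymm
  have hFinj : Function.Injective (mfderiv (𝓡 d) (𝓡 d) F (χ y₀)) := by
    have h1 : mfderiv (𝓡 d) (𝓡 d) F (χ y₀) = (mfderiv (𝓡 d) (𝓡 d) g (χ.symm (χ y₀))).comp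
        (mfderiv (𝓡 d) (𝓡 d) χ.symm (χ y₀)) :=
      mfderiv_comp (χ y₀) (hgat.mdifferentiableAt (by norm_num))
        (hsymm.mdifferentiableAt (by norm_num))
    rw [h1]
    exact (hder _ (by rw [he]; exact hy₀)).comp
      (injective_mfderiv_chart_symm y₀ (χ.map_source hy₀s))
  -- `q` is the Jacobian of `g`, read in the chart
  let q : EuclideanSpace ℝ (Fin d) → ℝ := fun v => mapDensity F v / volumeDensity y₀ v
  have hvpos : 0 < volumeDensity y₀ (χ y₀) := volumeDensity_pos y₀ (χ.map_source hy₀s)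
  have hFpos : 0 < mapDensity F (χ y₀) := mapDensity_pos hFinj
  have hFsm := contDiffAt_mapDensity hF hFinj
  have hq : ContDiffAt ℝ 1 (fun v => Real.log (q v)) (χ y₀) :=
    (hFsm.div (contDiffAt_volumeDensity y₀ (χ.map_source hy₀s)) hvpos.ne').log
      (div_pos hFpos hvpos).ne'
  obtain ⟨K, W, hW, hLip⟩ := hq.exists_lipschitzOnWith
  obtain ⟨K', ρ, hρ, hchart⟩ := exists_edist_chart_le (d := d) y₀
  have hcont : ContinuousAt χ y₀ := χ.continuousAt hy₀s
  have hgcont : ContinuousAt g y₀ := (hg.contMDiffAt (hU.mem_nhds hy₀)).continuousAt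
  -- near `y₀` all the coordinate expressions make sense and are controlled
  let T : Set M := {y | (y ∈ U ∧ y ∈ χ.source) ∧ (g y ∈ φ.source ∧ y ∈ eball y₀ ρ) ∧
    (χ y ∈ W ∧ 0 < mapDensity F (χ y))}
  have hT : T ∈ 𝓝 y₀ :=
    ((hU.eventually_mem hy₀).and (χ.open_source.eventually_mem hy₀s)).and
      (((hgcont.eventually (φ.open_source.eventually_mem (mem_chart_source _ _))).and
        (isOpen_eball.eventually_mem (mem_eball_self hρ))).and
      ((hcont.eventually hW).and
        (hcont.eventually (hFsm.continuousAt.eventually (lt_mem_nhds hFpos)))))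
  refine ⟨T, hT, 2 * (K * K'), by positivity, fun S hS r hr hdiam => ?_⟩
  rcases S.eq_empty_or_nonempty with rfl | ⟨s, hs⟩
  · refine ⟨1, one_ne_zero, fun E hE _ => ?_⟩
    obtain rfl := subset_empty_iff.1 hE
    simp
  have hqpos : ∀ y ∈ S, 0 < q (χ y) := fun y hy =>
    div_pos (hS hy).2.2.2 (volumeDensity_pos y₀ (χ.map_source (hS hy).1.2))
  have hlog : ∀ y ∈ S, |Real.log (q (χ y)) - Real.log (q (χ s))| ≤ K * K' * r := by
    intro y hy
    have h1 := hLip.dist_le_mul _ (hS hy).2.2.1 _ (hS hs).2.2.1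
    have h2 : edist (χ y) (χ s) ≤ ENNReal.ofReal (K' * r) := by
      refine (hchart y (hS hy).2.1.2 s (hS hs).2.1.2).trans ?_
      rw [ENNReal.ofReal_mul K'.coe_nonneg, ENNReal.ofReal_coe_nnreal]
      gcongr
      exact (edist_le_ediam_of_mem hy hs).trans hdiam
    rw [edist_dist, ENNReal.ofReal_le_ofReal_iff (by positivity)] at h2
    rw [Real.dist_eq] at h1
    calc _ ≤ K * dist (χ y) (χ s) := h1
      _ ≤ K * (K' * r) := by gcongr
      _ = _ := by ring
  set B := (K : ℝ) * K' * r with hB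
  have hqs := hqpos s hs
  have hlow : ∀ y ∈ S, q (χ s) * Real.exp (-B) ≤ q (χ y) := by
    intro y hy
    rw [← Real.log_le_log_iff (by positivity) (hqpos y hy),
      Real.log_mul hqs.ne' (Real.exp_ne_zero _), Real.log_exp]
    have := (abs_le.1 (hlog y hy)).1
    linarith
  have hup : ∀ y ∈ S, q (χ y) ≤ Real.exp (2 * B) * (q (χ s) * Real.exp (-B)) := by
    intro y hy
    rw [← Real.log_le_log_iff (hqpos y hy) (by positivity),
      Real.log_mul (Real.exp_ne_zero _) (by positivity),
      Real.log_mul hqs.ne' (Real.exp_ne_zero _), Real.log_exp, Real.log_exp]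
    have := (abs_le.1 (hlog y hy)).2
    linarith
  -- on `S` the Jacobian `q ∘ χ` lies between `c` and `exp (2 B) * c`
  set c := q (χ s) * Real.exp (-B) with hc
  have hcpos : 0 < c := by positivity
  refine ⟨ENNReal.ofReal c, (ENNReal.ofReal_pos.2 hcpos).ne', fun E hE hm => ?_⟩
  have hEU : E ⊆ U := fun y hy => (hS (hE hy)).1.1
  have hEs : E ⊆ χ.source := fun y hy => (hS (hE hy)).1.2
  have hgE : MapsTo g E φ.source := fun y hy => (hS (hE hy)).2.1.1
  have hgm := himg E hEU hm
  have hEm : MeasurableSet (χ '' E) := measurableSet_chart_image y₀ hEs hm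
  have e1 : riemannianVolume d M (g '' E) =
      ∫⁻ v in χ '' E, ENNReal.ofReal (mapDensity F v) := by
    rw [riemannianVolume_eq_chartVolume (g y₀) hgm hgE.image_subset,
      chartVolume_image (g y₀) y₀ hm hEs hgE (hinj.mono hEU) hgm
        (fun p hp => (hg.contMDiffAt (hU.mem_nhds (hEU hp))).continuousAt)
        (fun p hp => (hg.contMDiffAt (hU.mem_nhds (hEU hp))).mdifferentiableAt (by norm_num))]
  have e2 : riemannianVolume d M E =
      ∫⁻ v in χ '' E, ENNReal.ofReal (volumeDensity y₀ v) := by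
    rw [riemannianVolume_eq_chartVolume y₀ hm hEs, chartVolume_apply_of_subset y₀ hEs hm]
  have hfac : ∀ y ∈ E, mapDensity F (χ y) = q (χ y) * volumeDensity y₀ (χ y) := fun y hy =>
    (div_mul_cancel₀ _ (volumeDensity_pos y₀ (χ.map_source (hEs hy))).ne').symm
  have hvd : ∀ y ∈ E, 0 ≤ volumeDensity y₀ (χ y) := fun y hy =>
    (volumeDensity_pos y₀ (χ.map_source (hEs hy))).le
  rw [e1, e2, ← lintegral_const_mul' _ _ ENNReal.ofReal_ne_top,
    ← lintegral_const_mul' _ _ ENNReal.ofReal_ne_top]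
  constructor
  · refine setLIntegral_mono' hEm ?_
    rintro _ ⟨y, hy, rfl⟩
    rw [← ENNReal.ofReal_mul hcpos.le, hfac y hy]
    exact ENNReal.ofReal_le_ofReal (mul_le_mul_of_nonneg_right (hlow y (hE hy)) (hvd y hy))
  · refine setLIntegral_mono' hEm ?_
    rintro _ ⟨y, hy, rfl⟩
    rw [← ENNReal.ofReal_mul hcpos.le, ← ENNReal.ofReal_mul (Real.exp_nonneg _), hfac y hy,
      ← mul_assoc]
    refine ENNReal.ofReal_le_ofReal (mul_le_mul_of_nonneg_right ?_ (hvd y hy))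
    have := hup y (hE hy)
    rwa [show 2 * B = 2 * (K * K') * r by rw [hB]; ring] at this

end Distortion

/-! ### Inverse branches of a local diffeomorphism -/

section LocalInverse

variable {d : ℕ} {M : Type*} [TopologicalSpace M] [ChartedSpace (EuclideanSpace ℝ (Fin d)) M]
  {f : M → M}

/-- A local diffeomorphism has a `C²` inverse between neighbourhoods of `f x₀` and `x₀`. -/
lemma exists_local_inverse (hf : IsLocalDiffeomorph (𝓡 d) (𝓡 d) 2 f) (x₀ : M) :
    ∃ (g : M → M) (U V : Set M), IsOpen U ∧ IsOpen V ∧ f x₀ ∈ U ∧ x₀ ∈ V ∧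
      ContMDiffOn (𝓡 d) (𝓡 d) 2 g U ∧ MapsTo g U V ∧ MapsTo f V U ∧
      (∀ y ∈ U, f (g y) = y) ∧ ∀ x ∈ V, g (f x) = x := by
  have h := hf x₀
  refine ⟨h.localInverse, h.localInverse.source, h.localInverse.target,
    h.localInverse_open_source, h.localInverse.open_target, h.localInverse_mem_source,
    h.localInverse_mem_target, h.contmdiffOn_localInverse, fun y hy => ?_, fun x hx => ?_,
    fun y hy => h.localInverse_right_inv hy, fun x hx => h.localInverse_left_inv hx⟩
  · exact h.localInverse.map_source hy
  · have h1 := h.localInverse.map_target hx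
    have h2 := h.localInverse_right_inv h1
    rw [h.localInverse.right_inv hx] at h2
    rwa [h2]

lemma mfderiv_comp_eq_id {p q : M → M} {y : M} (hp : MDifferentiableAt (𝓡 d) (𝓡 d) p (q y))
    (hq : MDifferentiableAt (𝓡 d) (𝓡 d) q y) (h : p ∘ q =ᶠ[𝓝 y] id) :
    (mfderiv (𝓡 d) (𝓡 d) p (q y) : EuclideanSpace ℝ (Fin d) →L[ℝ] EuclideanSpace ℝ (Fin d)) ∘L
      (mfderiv (𝓡 d) (𝓡 d) q y : EuclideanSpace ℝ (Fin d) →L[ℝ] EuclideanSpace ℝ (Fin d)) =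
      ContinuousLinearMap.id ℝ _ :=
  (mfderiv_comp y hp hq).symm.trans (h.mfderiv_eq.trans mfderiv_id)

variable {g : M → M} {U V : Set M}

lemma injective_mfderiv_of_rightInverse (hf : ContMDiff (𝓡 d) (𝓡 d) 2 f) (hU : IsOpen U)
    (hg : ContMDiffOn (𝓡 d) (𝓡 d) 2 g U) (hfg : ∀ y ∈ U, f (g y) = y) {y : M} (hy : y ∈ U) :
    Function.Injective (mfderiv (𝓡 d) (𝓡 d) g y) := by
  have h := mfderiv_comp_eq_id (p := f) (q := g) ((hf _).mdifferentiableAt (by norm_num))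
    ((hg.contMDiffAt (hU.mem_nhds hy)).mdifferentiableAt (by norm_num))
    (by filter_upwards [hU.mem_nhds hy] with z hz using hfg z hz)
  exact fun v w hvw => by
    have h1 := DFunLike.congr_fun h v
    have h2 := DFunLike.congr_fun h w
    exact h1.symm.trans ((congrArg (mfderiv (𝓡 d) (𝓡 d) f (g y)) hvw).trans h2)

/-- The derivative of a local inverse of `f` is the inverse of the derivative of `f`. -/
lemma normDerivInv_eq [IsManifold (𝓡 d) ∞ M] [RiemannianBundle (fun x : M => TangentSpace (𝓡 d) x)]
    (hf : ContMDiff (𝓡 d) (𝓡 d) 2 f) (hU : IsOpen U) (hV : IsOpen V)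
    (hg : ContMDiffOn (𝓡 d) (𝓡 d) 2 g U) (hgU : MapsTo g U V)
    (hfg : ∀ y ∈ U, f (g y) = y) (hgf : ∀ x ∈ V, g (f x) = x) {y : M} (hy : y ∈ U) :
    normDerivInv d f (g y) = ‖mfderiv (𝓡 d) (𝓡 d) g y‖ := by
  have hgd : MDifferentiableAt (𝓡 d) (𝓡 d) g y :=
    (hg.contMDiffAt (hU.mem_nhds hy)).mdifferentiableAt (by norm_num)
  have hfd : MDifferentiableAt (𝓡 d) (𝓡 d) f (g y) := (hf _).mdifferentiableAt (by norm_num)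
  have h1 := mfderiv_comp_eq_id hfd hgd
    (by filter_upwards [hU.mem_nhds hy] with z hz using hfg z hz)
  have h2 := mfderiv_comp_eq_id (p := g) (q := f) (y := g y) (by rwa [hfg y hy]) hfd
    (by filter_upwards [hV.mem_nhds (hgU hy)] with z hz using hgf z hz)
  rw [hfg y hy] at h2
  have h3 : ContinuousLinearMap.inverse (mfderiv (𝓡 d) (𝓡 d) f (g y) :
      EuclideanSpace ℝ (Fin d) →L[ℝ] EuclideanSpace ℝ (Fin d)) = mfderiv (𝓡 d) (𝓡 d) g y :=
    ContinuousLinearMap.inverse_eq h1 h2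
  -- as the tangent spaces at `f (g y)` and at `y` are different types, each with its own norm, the
  -- norms of their linear maps are compared through a function of the base points
  let N : ∀ p q : M, (TangentSpace (𝓡 d) p →L[ℝ] TangentSpace (𝓡 d) q) → ℝ := fun p q A => ‖A‖
  have h4 : ∀ p, p = y → ∀ A : EuclideanSpace ℝ (Fin d) →L[ℝ] EuclideanSpace ℝ (Fin d),
      N p (g y) A = N y (g y) A := by
    rintro p rfl A
    rfl
  exact (congrArg (N (f (g y)) (g y)) h3).trans (h4 _ (hfg y hy) _)

variable [IsManifold (𝓡 d) ∞ M] [RiemannianBundle (fun x : M => TangentSpace (𝓡 d) x)]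

lemma normDerivInv_pos (hd : d ≠ 0) (hf : IsLocalDiffeomorph (𝓡 d) (𝓡 d) 2 f) (x : M) :
    0 < normDerivInv d f x := by
  obtain ⟨g, U, V, hU, hV, hxU, hxV, hg, hgU, -, hfg, hgf⟩ := exists_local_inverse hf x
  have h := normDerivInv_eq hf.contMDiff hU hV hg hgU hfg hgf hxU
  have hinj := injective_mfderiv_of_rightInverse hf.contMDiff hU hg hfg hxU
  have h' := congrArg (normDerivInv d f) (hgf x hxV)
  rw [← h', h]
  refine (norm_nonneg (mfderiv (𝓡 d) (𝓡 d) g (f x))).lt_of_ne' fun h0 => ?_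
  have h1 : mfderiv (𝓡 d) (𝓡 d) g (f x) = 0 :=
    norm_eq_zero (a := mfderiv (𝓡 d) (𝓡 d) g (f x)).1 h0
  rw [h1] at hinj
  have : Nonempty (Fin d) := ⟨⟨0, Nat.pos_of_ne_zero hd⟩⟩
  obtain ⟨v, hv⟩ := exists_ne (0 : EuclideanSpace ℝ (Fin d))
  exact hv (hinj (a₁ := v) (a₂ := (0 : EuclideanSpace ℝ (Fin d))) rfl)

lemma continuous_normDerivInv
    [IsContMDiffRiemannianBundle (𝓡 d) ∞ (EuclideanSpace ℝ (Fin d))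
      (fun x : M => TangentSpace (𝓡 d) x)] (hf : IsLocalDiffeomorph (𝓡 d) (𝓡 d) 2 f) :
    Continuous (normDerivInv d f) := by
  refine continuous_iff_continuousAt.2 fun x => ?_
  obtain ⟨g, U, V, hU, hV, hxU, hxV, hg, hgU, hfV, hfg, hgf⟩ := exists_local_inverse hf x
  have hM1 : IsManifold (𝓡 d) 1 M := IsManifold.of_le (n := ∞) (by simp)
  have hMc := isContinuousRiemannianBundle_of_contMDiff (d := d) (M := M)
  have h1 : ContinuousAt (fun y => ‖mfderiv (𝓡 d) (𝓡 d) g y‖) (f x) :=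
    continuousAt_norm_mfderiv ((hg.contMDiffAt (hU.mem_nhds hxU)).of_le (by norm_num))
  have h2 : ContinuousAt (fun z => ‖mfderiv (𝓡 d) (𝓡 d) g (f z)‖) x :=
    h1.comp (f := f) hf.contMDiff.continuous.continuousAt
  refine h2.congr ?_
  filter_upwards [hV.mem_nhds hxV] with z hz
  rw [← normDerivInv_eq hf.contMDiff hU hV hg hgU hfg hgf (hfV hz), hgf z hz]

end LocalInverse

section Branches

variable {d : ℕ} {M : Type*} [PseudoEMetricSpace M] [ChartedSpace (EuclideanSpace ℝ (Fin d)) M]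
  [IsManifold (𝓡 d) ∞ M] [RiemannianBundle (fun x : M => TangentSpace (𝓡 d) x)]
  [IsContMDiffRiemannianBundle (𝓡 d) ∞ (EuclideanSpace ℝ (Fin d))
      (fun x : M => TangentSpace (𝓡 d) x)] [IsRiemannianManifold (𝓡 d) M]
  [MeasurableSpace M] [BorelSpace M] {f : M → M}

/-- Near each point, a local diffeomorphism has inverse branches on balls of a fixed radius, whose
Lipschitz constants are almost the norm of the inverse derivative at the base point. -/
lemma exists_isBranch_nhds (hf : IsLocalDiffeomorph (𝓡 d) (𝓡 d) 2 f) {τ : ℝ} (hτ0 : 0 < τ)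
    (hτ1 : τ < 1) {x₀ : M} (ha : 0 < normDerivInv d f x₀) :
    ∃ W ∈ 𝓝 x₀, InjOn f W ∧
      (∃ δ : ℝ≥0∞, 0 < δ ∧ ∃ L : ℝ, 0 ≤ L ∧ ∀ x ∈ W, ∃ g,
        IsBranch (riemannianVolume d M) f (eball (f x) δ) x (τ⁻¹ * normDerivInv d f x) L g) ∧
      ∀ E, MeasurableSet E → riemannianVolume d M E = 0 →
        riemannianVolume d M (f ⁻¹' E ∩ W) = 0 := by
  obtain ⟨g, U, V, hU, hV, hxU, hxV, hg, hgU, hfV, hfg, hgf⟩ := exists_local_inverse hf x₀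
  have hM1 : IsManifold (𝓡 d) 1 M := IsManifold.of_le (n := ∞) (by simp)
  have hMc := isContinuousRiemannianBundle_of_contMDiff (d := d) (M := M)
  have hfc : Continuous f := hf.contMDiff.continuous
  have hac : Continuous (normDerivInv d f) := continuous_normDerivInv hf
  have haeq : ∀ y ∈ U, normDerivInv d f (g y) = ‖mfderiv (𝓡 d) (𝓡 d) g y‖ := fun y hy =>
    normDerivInv_eq hf.contMDiff hU hV hg hgU hfg hgf hy
  have hg1 : ContMDiffOn (𝓡 d) (𝓡 d) 1 g U := hg.of_le (by norm_num)
  -- near `x₀`, the constant `K` lies between the norm of the derivative of the local inverse and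
  -- the required Lipschitz constant
  obtain ⟨K, hK, hKτ⟩ : ∃ K, normDerivInv d f x₀ < K ∧ K < τ⁻¹ * normDerivInv d f x₀ :=
    exists_between (lt_mul_of_one_lt_left ha ((one_lt_inv₀ hτ0).2 hτ1))
  have hK0 : 0 < K := ha.trans hK
  have himage : ∀ E ⊆ U, g '' E = V ∩ f ⁻¹' E := by
    intro E hE
    ext x
    constructor
    · rintro ⟨y, hy, rfl⟩
      exact ⟨hgU (hE hy), by rw [mem_preimage, hfg y (hE hy)]; exact hy⟩
    · rintro ⟨hx, hy⟩
      exact ⟨f x, hy, hgf x hx⟩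
  have himg : ∀ E ⊆ U, MeasurableSet E → MeasurableSet (g '' E) := fun E hE hm => by
    rw [himage E hE]
    exact hV.measurableSet.inter (hfc.measurable hm)
  have hginj : InjOn g U := fun y hy z hz h => by rw [← hfg y hy, h, hfg z hz]
  obtain ⟨T, hT, L, hL, hdist⟩ := exists_distortion_bound hU hg hginj
    (fun y hy => injective_mfderiv_of_rightInverse hf.contMDiff hU hg hfg hy) himg hxU
  have hnorm : ∀ᶠ y in 𝓝 (f x₀), ‖mfderiv (𝓡 d) (𝓡 d) g y‖ < K := by
    refine (continuousAt_norm_mfderiv (hg1.contMDiffAt (hU.mem_nhds hxU))).eventually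
      (gt_mem_nhds ?_)
    have h := congrArg (normDerivInv d f) (hgf _ hxV)
    exact ((haeq _ hxU).symm.trans h).trans_lt hK
  obtain ⟨R, hR, hRsub⟩ := EMetric.mem_nhds_iff.1 (inter_mem (hU.mem_nhds hxU) hnorm)
  obtain ⟨ρ, hρ, hρsub⟩ := EMetric.mem_nhds_iff.1 (inter_mem hT
    (inter_mem (eball_mem_nhds (f x₀) (ENNReal.div_pos hR.ne' (by norm_num : (3 : ℝ≥0∞) ≠ ⊤)))
      (eball_mem_nhds (f x₀) one_pos)))
  have hρU : eball (f x₀) ρ ⊆ U := fun y hy =>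
    (hRsub ((hρsub hy).2.1.trans_le (ENNReal.div_le_of_le_mul (by
      exact le_mul_of_one_le_right' (by norm_num))))).1
  have hδ : 0 < ρ / 2 := ENNReal.div_pos hρ.ne' (by norm_num)
  refine ⟨V ∩ (f ⁻¹' eball (f x₀) (ρ / 2) ∩ {x | K < τ⁻¹ * normDerivInv d f x}),
    inter_mem (hV.mem_nhds hxV) (inter_mem (hfc.continuousAt (eball_mem_nhds _ hδ))
      ((continuous_const.mul hac).continuousAt.eventually (lt_mem_nhds hKτ))),
    fun x hx y hy h => by rw [← hgf x hx.1, h, hgf y hy.1],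
    ⟨ρ / 2, hδ, L, hL, fun x hx => ⟨g, ?_⟩⟩, fun E hE hE0 => ?_⟩
  · have hsub : eball (f x) (ρ / 2) ⊆ eball (f x₀) ρ := fun y hy => by
      calc edist y (f x₀) ≤ edist y (f x) + edist (f x) (f x₀) := edist_triangle _ _ _
        _ < ρ / 2 + ρ / 2 := ENNReal.add_lt_add hy hx.2.1
        _ = ρ := ENNReal.add_halves ρ
    refine ⟨hgf x hx.1, fun y hy => hfg y (hρU (hsub hy)), fun y hy z hz => ?_,
      fun E hE => himg E ((hE.trans hsub).trans hρU), fun S hS => hdist S fun y hy =>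
        (hρsub (hsub (hS hy))).1⟩
    have h := edist_le_of_enorm_mfderiv_le (K := K.toNNReal)
      (hg1.mono fun w hw => (hRsub hw).1) (fun w hw => ?_)
      (hρsub (hsub hy)).2.1 (hρsub (hsub hz)).2.1
    · exact h.trans (mul_le_mul_left (ENNReal.ofReal_le_ofReal hx.2.2.le) _)
    · rw [← ofReal_norm]
      exact ENNReal.ofReal_le_ofReal (hRsub hw).2.le
  -- the preimages in this neighbourhood are the images under `g` of null sets
  · have hdiam : ediam (eball (f x₀) ρ) ≤ ENNReal.ofReal 2 := by
      refine ediam_le fun y hy z hz => ?_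
      calc edist y z ≤ edist y (f x₀) + edist z (f x₀) := edist_triangle_right _ _ _
        _ ≤ 1 + 1 := add_le_add (hρsub hy).2.2.le (hρsub hz).2.2.le
        _ = ENNReal.ofReal 2 := by norm_num
    obtain ⟨c, -, hc⟩ := hdist _ (fun y hy => (hρsub hy).1) 2 (by norm_num) hdiam
    have h0 := (hc (E ∩ eball (f x₀) ρ) inter_subset_right
      (hE.inter isOpen_eball.measurableSet)).2
    rw [measure_mono_null inter_subset_left hE0, mul_zero, mul_zero] at h0
    refine measure_mono_null ?_ (nonpos_iff_eq_zero.1 h0)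
    rintro x ⟨hxE, hx, hxB, -⟩
    exact ⟨f x, ⟨hxE, eball_subset_eball ENNReal.half_le_self hxB⟩, hgf x hx⟩

end Branches

/-! ### Uniform inverse branches on a compact manifold -/

section Frequency

variable {d : ℕ} {M : Type*} [PseudoEMetricSpace M] [CompactSpace M]
  [ChartedSpace (EuclideanSpace ℝ (Fin d)) M]
  [IsManifold (𝓡 d) ∞ M] [RiemannianBundle (fun x : M => TangentSpace (𝓡 d) x)]
  [IsContMDiffRiemannianBundle (𝓡 d) ∞ (EuclideanSpace ℝ (Fin d))
      (fun x : M => TangentSpace (𝓡 d) x)] [IsRiemannianManifold (𝓡 d) M]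
  [MeasurableSpace M] [BorelSpace M] {f : M → M}

/-- By compactness, the inverse branches of a local diffeomorphism are defined on balls of a
uniform radius `δ`, on which the map is injective, and have uniformly bounded distortion; moreover
null sets have null preimages. -/
lemma exists_uniform_isBranch (hf : IsLocalDiffeomorph (𝓡 d) (𝓡 d) 2 f) {τ : ℝ} (hτ0 : 0 < τ)
    (hτ1 : τ < 1) (ha : ∀ x, 0 < normDerivInv d f x) :
    ∃ δ : ℝ≥0∞, 0 < δ ∧ δ ≠ ⊤ ∧ ∃ L : ℝ, 0 ≤ L ∧
      (∀ x, ∃ g, IsBranch (riemannianVolume d M) f (eball (f x) δ) x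
        (τ⁻¹ * normDerivInv d f x) L g) ∧
      (∀ x y, edist x y < δ → f x = f y → x = y) ∧
      ∀ E, MeasurableSet E → riemannianVolume d M E = 0 → riemannianVolume d M (f ⁻¹' E) = 0 := by
  choose W hW hinj hbr hnull using fun x => exists_isBranch_nhds hf hτ0 hτ1 (ha x)
  obtain ⟨⟨δ₁, hδ₁, L, hL, hbr'⟩, hnull'⟩ :
      (∃ δ : ℝ≥0∞, 0 < δ ∧ ∃ L : ℝ, 0 ≤ L ∧ ∀ x ∈ (univ : Set M), ∃ g,
        IsBranch (riemannianVolume d M) f (eball (f x) δ) x (τ⁻¹ * normDerivInv d f x) L g) ∧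
      ∀ E, MeasurableSet E → riemannianVolume d M E = 0 →
        riemannianVolume d M (f ⁻¹' E ∩ univ) = 0 := by
    refine isCompact_univ.induction_on ⟨⟨1, one_pos, 0, le_rfl, by simp⟩, by simp⟩
      ?_ ?_ fun x _ => ⟨W x, mem_nhdsWithin_of_mem_nhds (hW x), hbr x, hnull x⟩
    · rintro s t hst ⟨⟨δ, hδ, L, hL, h⟩, h'⟩
      exact ⟨⟨δ, hδ, L, hL, fun x hx => h x (hst hx)⟩, fun E hE h0 =>
        measure_mono_null (inter_subset_inter_right _ hst) (h' E hE h0)⟩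
    · rintro s t ⟨⟨δ, hδ, L, hL, h⟩, h'⟩ ⟨⟨η, hη, K, hK, k⟩, k'⟩
      refine ⟨⟨min δ η, lt_min hδ hη, max L K, hL.trans (le_max_left _ _), ?_⟩, fun E hE h0 => ?_⟩
      · rintro x (hx | hx)
        · obtain ⟨g, hg⟩ := h x hx
          exact ⟨g, (hg.mono le_rfl (le_max_left _ _)).mono_set
            (eball_subset_eball (min_le_left _ _))⟩
        · obtain ⟨g, hg⟩ := k x hx
          exact ⟨g, (hg.mono le_rfl (le_max_right _ _)).mono_set
            (eball_subset_eball (min_le_right _ _))⟩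
      · rw [inter_union_distrib_left]
        exact measure_union_null (h' E hE h0) (k' E hE h0)
  obtain ⟨δ₂, hδ₂, hleb⟩ := lebesgue_number_lemma_of_emetric (isCompact_univ (X := M))
    (c := fun x => interior (W x)) (fun _ => isOpen_interior)
    (fun x _ => mem_iUnion.2 ⟨x, mem_interior_iff_mem_nhds.2 (hW x)⟩)
  refine ⟨min (min δ₁ δ₂) 1, by simp [hδ₁, hδ₂],
    ((min_le_right _ _).trans_lt ENNReal.one_lt_top).ne, L, hL, fun x => ?_,
    fun x y hxy hfxy => ?_, fun E hE h0 => by simpa using hnull' E hE h0⟩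
  · obtain ⟨g, hg⟩ := hbr' x (mem_univ x)
    exact ⟨g, hg.mono_set (eball_subset_eball ((min_le_left _ _).trans (min_le_left _ _)))⟩
  · obtain ⟨z, hz⟩ := hleb x (mem_univ x)
    refine hinj z (interior_subset (hz (mem_eball_self hδ₂))) (interior_subset (hz ?_)) hfxy
    rw [mem_eball, edist_comm]
    exact hxy.trans_le ((min_le_left _ _).trans (min_le_right _ _))

/-- The theorem in positive dimension, for the Riemannian distance. -/
lemma exists_frequencyGreater (hd : d ≠ 0) (hf : IsLocalDiffeomorph (𝓡 d) (𝓡 d) 2 f)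
    {σ : ℝ} (hσ0 : 0 < σ) (hσ1 : σ < 1)
    (hdef : ∀ᵐ x ∂(lebesgue d M), ∃ n : ℕ, IsHyperbolicTime d f σ x n)
    (hint : Integrable (fun x : M => (firstHyperbolicTime d f σ x : ℝ)) (lebesgue d M)) :
    ∃ σ' θ : ℝ, 0 < σ' ∧ σ' < 1 ∧ 0 < θ ∧ ∀ᵐ x ∂(lebesgue d M), FrequencyGreater d f σ' x θ := by
  have ha : ∀ x, 0 < normDerivInv d f x := normDerivInv_pos hd hf
  have hac := continuous_normDerivInv hf
  have hfc : Continuous f := hf.contMDiff.continuous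
  have htop : riemannianVolume d M univ ≠ ⊤ := riemannianVolume_univ_lt_top.ne
  have hfin : IsFiniteMeasure (lebesgue d M) := ⟨by
    rw [lebesgue, Measure.smul_apply, smul_eq_mul]
    exact (ENNReal.inv_mul_le_one _).trans_lt ENNReal.one_lt_top⟩
  have hnull : ∀ E, lebesgue d M E = 0 ↔ riemannianVolume d M E = 0 := fun E => by
    simp [lebesgue, htop]
  -- hyperbolic times for `τ ^ 2 = σ` have controlled inverse branches
  have hτ0 : 0 < √σ := Real.sqrt_pos.2 hσ0
  have hτ1 : √σ < 1 := by rw [Real.sqrt_lt' one_pos]; simpa using hσ1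
  obtain ⟨δ, hδ, hδtop, L, hL, hbr, hinj, hns⟩ := exists_uniform_isBranch hf hτ0 hτ1 ha
  obtain ⟨C, hC, hbound⟩ := exists_measure_isHypTime_inter_preimage_le (μ := lebesgue d M)
    hτ0 hτ1 hL (fun x => (ha x).le) hδ hδtop
    (fun x r hr => by
      rw [Ne, hnull]
      exact riemannianVolume_ne_zero_of_isOpen isOpen_eball ⟨x, mem_eball_self hr⟩)
    (fun x => (hbr x).imp fun g hg => hg.const_smul _) hinj
  rw [Real.sq_sqrt hσ0.le] at hbound
  obtain ⟨ν, hνfin, hνμ, hν⟩ := exists_dominating_measure hfc hac (fun x => (ha x).le) hσ0.le hC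
    (fun E hE h0 => (hnull _).2 (hns E hE ((hnull E).1 h0))) hbound hdef hint
  exact exists_frequency_isHypTime hfc hac ha hνμ hν hσ0 hσ1 hdef

end Frequency

/-- In dimension zero all derivatives vanish, so every positive integer is a hyperbolic time. -/
lemma isHyperbolicTime_of_dim_zero {M : Type*} [TopologicalSpace M]
    [ChartedSpace (EuclideanSpace ℝ (Fin 0)) M] [IsManifold (𝓡 0) ∞ M]
    [RiemannianBundle (fun x : M => TangentSpace (𝓡 0) x)]
    (f : M → M) {σ : ℝ} (hσ : 0 ≤ σ) (x : M) {n : ℕ} (hn : 1 ≤ n) :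
    IsHyperbolicTime 0 f σ x n := by
  have h0 : ∀ y, normDerivInv 0 f y = 0 := fun y => by
    have h : (mfderiv (𝓡 0) (𝓡 0) f y).inverse = 0 := by
      ext1 v
      exact Subsingleton.elim (α := EuclideanSpace ℝ (Fin 0)) _ _
    exact (congrArg (fun A => ‖A‖) h).trans
      (norm_zero (E := TangentSpace (𝓡 0) (f y) →L[ℝ] TangentSpace (𝓡 0) y))
  refine ⟨hn, fun k hk hkn => ?_⟩
  rw [Finset.prod_eq_zero (Finset.mem_Ico.2 ⟨le_rfl, Nat.sub_lt hn hk⟩) (h0 _)]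
  positivity

end HyperbolicTimes

theorem theoremD {d : ℕ} {M : Type*} [TopologicalSpace M] [CompactSpace M] [T2Space M]
    [ChartedSpace (EuclideanSpace ℝ (Fin d)) M] [IsManifold (𝓡 d) ∞ M]
    [Bundle.RiemannianBundle (fun x : M => TangentSpace (𝓡 d) x)]
    [IsContMDiffRiemannianBundle (𝓡 d) ∞ (EuclideanSpace ℝ (Fin d))
      (fun x : M => TangentSpace (𝓡 d) x)]
    [MeasurableSpace M] [BorelSpace M]
    (f : M → M) (hf : IsLocalDiffeomorph (𝓡 d) (𝓡 d) 2 f)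
    (σ : ℝ) (hσ0 : 0 < σ) (hσ1 : σ < 1)
    (hdefined : ∀ᵐ x ∂(HyperbolicTimes.lebesgue d M),
      ∃ n : ℕ, HyperbolicTimes.IsHyperbolicTime d f σ x n)
    (hint : MeasureTheory.Integrable
      (fun x : M => (HyperbolicTimes.firstHyperbolicTime d f σ x : ℝ))
      (HyperbolicTimes.lebesgue d M)) :
    ∃ σ' θ : ℝ, 0 < σ' ∧ σ' < 1 ∧ 0 < θ ∧
      ∀ᵐ x ∂(HyperbolicTimes.lebesgue d M),
        HyperbolicTimes.FrequencyGreater d f σ' x θ := by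
  rcases eq_or_ne d 0 with rfl | hd
  · refine ⟨1 / 2, 1, by norm_num, by norm_num, one_pos, .of_forall fun x => .of_forall fun n => ?_⟩
    refine ⟨Finset.Icc 1 n, fun i hi => ?_, by simp⟩
    rw [Finset.mem_Icc] at hi
    exact ⟨hi.2, HyperbolicTimes.isHyperbolicTime_of_dim_zero f (by norm_num) x hi.1⟩
  have hM1 : IsManifold (𝓡 d) 1 M := IsManifold.of_le (n := ∞) (by simp)
  have hMc := HyperbolicTimes.isContinuousRiemannianBundle_of_contMDiff (d := d) (M := M)
  -- the Riemannian distance induces the given topology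
  let : PseudoEMetricSpace M := .ofRiemannianMetric (𝓡 d) M
  have : IsRiemannianManifold (𝓡 d) M := inferInstance
  exact HyperbolicTimes.exists_frequencyGreater hd hf hσ0 hσ1 hdefined hint
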